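/- For a complex number $q$ with $0<|q|<1$ write $(x;q)_n=\prod_{i=0}^{n-1}(1-q^ix)$, $(x;q)_\infty=\prod_{i\ge 0}(1-q^ix)$, $J_a=(q^a;q^a)_\infty=\prod_{i\ge1}(1-q^{ai})$ for integers $a\ge 1$, and $\zeta_3=e^{2\pi i/3}$. Let $$\omega_3(q)=\sum_{n=0}^{\infty}\frac{q^{2n(n+1)}}{(q;q^2)_{n+1}^2}$$ be the third-order mock theta function. Then for every complex $q$ with $0<|q|<1$, all the series and products below converge (the series absolutely), and $$2q^{2}\omega_{3}(q^3)=-\frac{2i}{\sqrt{3}}+\frac{2}{3}\,\frac{J_{2}^4}{J_{6}J_{1}^2}-\frac{4}{3}\,\frac{e^{-\pi i/3}}{(q^6;q^6)_{\infty}}\sum_{n\in\mathbb{Z}}\frac{(-1)^{n}\zeta_{3}^{2n}q^{n^2+n}}{1-\zeta_{3}q^{2n+1}}.$$ -/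

import Mathlib

namespace MockTheta

noncomputable section

/-- The finite `q`-Pochhammer symbol `(x; q)_n = ∏_{i=0}^{n-1} (1 - q^i x)`. -/
def qPoch (x q : ℂ) (n : ℕ) : ℂ := ∏ i ∈ Finset.range n, (1 - q ^ i * x)

/-- The infinite `q`-Pochhammer symbol `(x; q)_∞ = ∏_{i ≥ 0} (1 - q^i x)`. -/
def qPochInf (x q : ℂ) : ℂ := ∏' i : ℕ, (1 - q ^ i * x)

/-- The product `J_a = ∏_{i ≥ 1} (1 - q^{a i})`, that is, `(q^a; q^a)_∞`. -/
def J (a : ℕ) (q : ℂ) : ℂ := qPochInf (q ^ a) (q ^ a)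

/-- The general term `q^{2n(n+1)} / (q; q²)_{n+1}²` of the series defining `ω₃(q)`. -/
def omega3Term (q : ℂ) (n : ℕ) : ℂ := q ^ (2 * n * (n + 1)) / qPoch q (q ^ 2) (n + 1) ^ 2

/-- The third-order mock theta function `ω₃(q)`. -/
def omega3 (q : ℂ) : ℂ := ∑' n : ℕ, omega3Term q n

/-- The primitive third root of unity `ζ₃ = e^{2πi/3}`. -/
def zeta3 : ℂ := Complex.exp (2 * Real.pi * Complex.I / 3)

/-- The general term `(-1)^n ζ₃^{2n} q^{n²+n} / (1 - ζ₃ q^{2n+1})` of the bilateral sum. -/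
def bilateralTerm (q : ℂ) (n : ℤ) : ℂ :=
  (-1) ^ n * zeta3 ^ (2 * n) * q ^ (n ^ 2 + n) / (1 - zeta3 * q ^ (2 * n + 1))

end

end MockTheta

namespace MockTheta

open Filter Topology

/-! ### Finite and infinite q-Pochhammer symbols. -/

section Pochhammer

/-! Write F = (q^6;q^6)_∞ and A(x) = Σ (-1)^n x^{2n} q^{n²+n}/(1 - x q^{2n+1}) (`appellTerm`), so
that the bilateral sum of the theorem is A(ζ₃). The proof evaluates A(1) + ζ₃A(ζ₃) + ζ₃²A(ζ₃²) in
two ways.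

On one side, splitting n modulo 3 and adding over the cube roots of unity replaces the denominators
by 1 - q^{3(2n+1)}. The combination becomes 3q² times a combination of three sextic Appell sums in Q
= q³ (`one_add_zeta3_combination`), and that combination equals F ω₃(q³)
(`universal_mock_eq_sexticSum`). The latter rests on a Bailey-type expansion (`tsum_universal_mock`)
of (Q²;Q²)_∞ ω₃(Q) as Σ (-1)^l Q^{3l²+3l}/(1 - Q^{2l+1}), and on one linear relation between sextic
sums (`sexticSum_change`), found by partial fractions with two families of poles.

On the other side, A(1) is a product, because a reciprocal theta function has an explicit partial
fraction expansion (`tsum_appell_one`). The reflection n ↦ -1-n relates A(ζ₃) to A(ζ₃²) up to a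
theta series, which the Jacobi triple product evaluates as a multiple of F
(`tsum_appellTerm_zeta3`). Eliminating A(ζ₃²) gives A(1) + 2ζ₃A(ζ₃) - i√3 F = 3q² F ω₃(q³); dividing
by F and using e^{-πi/3} = -ζ₃ gives the claim.

The analytic identities behind this are limits of finite ones, which come from Lagrange
interpolation (`partial_fractions`), the q-binomial theorem or a Durfee-type summation; dominated
convergence passes to the limit. -/

lemma qPoch_zero (x q : ℂ) : qPoch x q 0 = 1 := by simp [qPoch]

lemma qPoch_succ (x q : ℂ) (n : ℕ) : qPoch x q (n + 1) = qPoch x q n * (1 - q ^ n * x) := by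
  simp [qPoch, Finset.prod_range_succ]

lemma qPoch_succ' (x q : ℂ) (n : ℕ) : qPoch x q (n + 1) = (1 - x) * qPoch (q * x) q n := by
  simp only [qPoch, Finset.prod_range_succ', pow_zero, one_mul, pow_succ, mul_assoc]
  rw [mul_comm]

lemma qPoch_ne_zero {x q : ℂ} (h : ∀ i : ℕ, 1 - q ^ i * x ≠ 0) (n : ℕ) : qPoch x q n ≠ 0 :=
  Finset.prod_ne_zero_iff.mpr fun i _ => h i

lemma one_sub_pow_mul_ne_zero {x q : ℂ} (hq : ‖q‖ < 1) (hx : ‖x‖ < 1) (i : ℕ) :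
    1 - q ^ i * x ≠ 0 := by
  intro h
  have h1 : ‖q ^ i * x‖ = 1 := by rw [← sub_eq_zero.mp h]; simp
  rw [norm_mul, norm_pow] at h1
  have h2 : ‖q‖ ^ i ≤ 1 := pow_le_one₀ (norm_nonneg _) hq.le
  nlinarith [norm_nonneg x]

lemma qPoch_self_ne_zero {q : ℂ} (hq : ‖q‖ < 1) (n : ℕ) : qPoch q q n ≠ 0 :=
  qPoch_ne_zero (one_sub_pow_mul_ne_zero hq hq) n

lemma summable_norm_pow_mul {q : ℂ} (hq : ‖q‖ < 1) (x : ℂ) :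
    Summable fun i : ℕ => ‖-(q ^ i * x)‖ := by
  simp only [norm_neg, norm_mul, norm_pow]
  exact (summable_geometric_of_lt_one (norm_nonneg _) hq).mul_right _

lemma multipliable_one_sub_pow_mul {q : ℂ} (hq : ‖q‖ < 1) (x : ℂ) :
    Multipliable fun i : ℕ => 1 - q ^ i * x := by
  simpa [sub_eq_add_neg] using multipliable_one_add_of_summable (summable_norm_pow_mul hq x)

lemma tendsto_qPoch {q : ℂ} (hq : ‖q‖ < 1) (x : ℂ) :
    Tendsto (qPoch x q) atTop (𝓝 (qPochInf x q)) :=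
  (multipliable_one_sub_pow_mul hq x).tendsto_prod_tprod_nat

lemma qPochInf_ne_zero {x q : ℂ} (hq : ‖q‖ < 1) (h : ∀ i : ℕ, 1 - q ^ i * x ≠ 0) :
    qPochInf x q ≠ 0 := by
  have := tprod_one_add_ne_zero_of_summable (f := fun i : ℕ => -(q ^ i * x))
    (fun i => by simpa [sub_eq_add_neg] using h i) (summable_norm_pow_mul hq x)
  simpa [qPochInf, sub_eq_add_neg] using this

lemma qPochInf_self_ne_zero {q : ℂ} (hq : ‖q‖ < 1) : qPochInf q q ≠ 0 :=
  qPochInf_ne_zero hq (one_sub_pow_mul_ne_zero hq hq)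

lemma qPochInf_eq_mul {q : ℂ} (hq : ‖q‖ < 1) (x : ℂ) :
    qPochInf x q = (1 - x) * qPochInf (q * x) q := by
  refine tendsto_nhds_unique ((tendsto_add_atTop_iff_nat 1).mpr (tendsto_qPoch hq x)) ?_
  simp only [qPoch_succ']
  exact (tendsto_qPoch hq (q * x)).const_mul _

end Pochhammer

/-! ### Absolute convergence of theta and Appell series. -/

section Summability

lemma summable_zpow_mul_gaussian {R : ℂ} (hR0 : R ≠ 0) (hR : ‖R‖ < 1) (a : ℂ) (ha : a ≠ 0) :
    Summable fun l : ℤ => a ^ l * R ^ (l ^ 2 + l) := by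
  have key : ∀ a : ℂ, a ≠ 0 → Summable fun n : ℕ => a ^ n * R ^ (n ^ 2) := by
    intro a ha
    refine summable_of_ratio_test_tendsto_lt_one (l := 0) one_pos
      (Eventually.of_forall fun n => by positivity) ?_
    have : ∀ n : ℕ, ‖a ^ (n + 1) * R ^ ((n + 1) ^ 2)‖ / ‖a ^ n * R ^ (n ^ 2)‖
        = ‖a * R‖ * (‖R‖ ^ 2) ^ n := by
      intro n
      rw [← norm_div, ← norm_pow, ← norm_pow, ← norm_mul]
      congr 1
      rw [div_eq_iff (by positivity)]
      ring
    simp only [this]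
    have h2 : ‖R‖ ^ 2 < 1 := pow_lt_one₀ (norm_nonneg _) hR two_ne_zero
    simpa using (tendsto_pow_atTop_nhds_zero_of_lt_one (by positivity) h2).const_mul ‖a * R‖
  refine Summable.of_nat_of_neg ?_ ?_
  · refine (key (a * R) (by positivity)).congr fun n => ?_
    rw [zpow_add₀ hR0, mul_pow]
    norm_cast
    ring
  · refine (key ((a * R)⁻¹) (by positivity)).congr fun n => ?_
    rw [zpow_add₀ hR0, neg_sq, inv_pow, mul_pow, zpow_neg, zpow_neg]
    norm_cast
    field_simp

/-- As l → -∞ the power y^l blows up, and as l → ∞ it vanishes. Stating this cofinitely spares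
`summable_appell` any hypothesis that the denominators are nonzero. -/
lemma eventually_one_half_le_norm_one_sub {y : ℂ} (hy0 : y ≠ 0) (hy : ‖y‖ < 1) (x : ℂ)
    (hx : x ≠ 0) : ∀ᶠ l : ℤ in cofinite, 1 / 2 ≤ ‖1 - x * y ^ l‖ := by
  have hyp : 0 < ‖y‖ := norm_pos_iff.mpr hy0
  have hxp : 0 < ‖x‖ := norm_pos_iff.mpr hx
  rw [Int.cofinite_eq, eventually_sup]
  constructor
  · have h : Tendsto (fun n : ℕ => ‖x‖ * (‖y‖⁻¹) ^ n) atTop atTop :=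
      (tendsto_pow_atTop_atTop_of_one_lt ((one_lt_inv₀ hyp).mpr hy)).const_mul_atTop hxp
    obtain ⟨N, hN⟩ := eventually_atTop.mp (h.eventually_ge_atTop 2)
    refine eventually_atBot.mpr ⟨-N, fun l hl => ?_⟩
    have h1 := hN l.natAbs (by omega)
    have h2 : ‖x * y ^ l‖ = ‖x‖ * (‖y‖⁻¹) ^ l.natAbs := by
      rw [norm_mul, norm_zpow, inv_pow, ← zpow_natCast, ← zpow_neg]
      congr 2
      omega
    have h3 := norm_sub_norm_le (x * y ^ l) 1
    rw [norm_sub_rev, norm_one] at h3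
    linarith
  · have h : Tendsto (fun n : ℕ => ‖x‖ * ‖y‖ ^ n) atTop (𝓝 0) := by
      simpa using (tendsto_pow_atTop_nhds_zero_of_lt_one hyp.le hy).const_mul ‖x‖
    obtain ⟨N, hN⟩ := eventually_atTop.mp (h.eventually_le_const (by norm_num : (0 : ℝ) < 1 / 2))
    refine eventually_atTop.mpr ⟨N, fun l hl => ?_⟩
    have h1 := hN l.natAbs (by omega)
    have h2 : ‖x * y ^ l‖ = ‖x‖ * ‖y‖ ^ l.natAbs := by
      rw [norm_mul, norm_zpow, ← zpow_natCast]
      congr 2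
      omega
    have h3 := norm_sub_norm_le 1 (x * y ^ l)
    rw [norm_one] at h3
    linarith

lemma summable_appell {R y : ℂ} (hR0 : R ≠ 0) (hR : ‖R‖ < 1) (hy0 : y ≠ 0) (hy : ‖y‖ < 1)
    {a x : ℂ} (ha : a ≠ 0) (hx : x ≠ 0) :
    Summable fun l : ℤ => a ^ l * R ^ (l ^ 2 + l) / (1 - x * y ^ l) := by
  refine Summable.of_norm_bounded_eventually
    ((summable_zpow_mul_gaussian hR0 hR a ha).norm.mul_left 2) ?_
  filter_upwards [eventually_one_half_le_norm_one_sub hy0 hy x hx] with l hl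
  rw [norm_div, div_le_iff₀ (by linarith)]
  nlinarith [norm_nonneg (a ^ l * R ^ (l ^ 2 + l))]

end Summability

/-! ### Passage from finite to infinite sums. -/

section Limits

lemma exists_norm_le_of_tendsto {w : ℕ → ℂ} {α : ℂ} (h : Tendsto w atTop (𝓝 α)) :
    ∃ C, 0 ≤ C ∧ ∀ n, ‖w n‖ ≤ C := by
  obtain ⟨C, hC⟩ := (Metric.isBounded_range_of_tendsto w h).exists_norm_le
  exact ⟨C, (norm_nonneg _).trans (hC _ ⟨0, rfl⟩), fun n => hC _ ⟨n, rfl⟩⟩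

/-- Tannery's theorem: convergent weights are bounded, so a multiple of ‖g‖ dominates. The two ends
are independent because the Bailey sum below is asymmetric, with s = n + 1 and t = n. -/
lemma tendsto_sum_Icc_weighted {w w' : ℕ → ℂ} {α β : ℂ} {g : ℤ → ℂ} {s t : ℕ → ℕ}
    (hw : Tendsto w atTop (𝓝 α)) (hw' : Tendsto w' atTop (𝓝 β)) (hg : Summable g)
    (hs : Tendsto s atTop atTop) (ht : Tendsto t atTop atTop) :
    Tendsto (fun n => ∑ l ∈ Finset.Icc (-(s n : ℤ)) (t n),
      w (s n + l).toNat * w' (t n - l).toNat * g l) atTop (𝓝 (α * β * ∑' l, g l)) := by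
  obtain ⟨C, hC0, hC⟩ := exists_norm_le_of_tendsto hw
  obtain ⟨D, hD0, hD⟩ := exists_norm_le_of_tendsto hw'
  have key := tendsto_tsum_of_dominated_convergence (𝓕 := atTop)
    (f := fun n l => if l ∈ Finset.Icc (-(s n : ℤ)) (t n) then
      w (s n + l).toNat * w' (t n - l).toNat * g l else 0)
    (g := fun l => α * β * g l) (bound := fun l => C * D * ‖g l‖)
    (hg.norm.mul_left _) ?_ ?_
  · rw [tsum_mul_left] at key
    refine key.congr fun n => ?_
    rw [tsum_eq_sum (s := Finset.Icc (-(s n : ℤ)) (t n)) (fun l hl => if_neg hl)]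
    exact Finset.sum_congr rfl fun l hl => if_pos hl
  · intro l
    have h1 : Tendsto (fun n => (s n + l).toNat) atTop atTop := by
      refine tendsto_atTop.mpr fun b => ?_
      filter_upwards [hs.eventually_ge_atTop (b + l.natAbs)] with n hn
      omega
    have h2 : Tendsto (fun n => (t n - l).toNat) atTop atTop := by
      refine tendsto_atTop.mpr fun b => ?_
      filter_upwards [ht.eventually_ge_atTop (b + l.natAbs)] with n hn
      omega
    refine (((hw.comp h1).mul (hw'.comp h2)).mul_const (g l)).congr' ?_
    filter_upwards [hs.eventually_ge_atTop l.natAbs, ht.eventually_ge_atTop l.natAbs] with n h3 h4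
    rw [if_pos (Finset.mem_Icc.mpr (by omega))]
    rfl
  · refine Eventually.of_forall fun n l => ?_
    split_ifs
    · rw [norm_mul, norm_mul]
      gcongr
      · exact hC _
      · exact hD _
    · rw [norm_zero]; positivity

lemma tendsto_sum_range_weighted {w g : ℕ → ℂ} {α : ℂ} (hw : Tendsto w atTop (𝓝 α))
    (hg : Summable g) :
    Tendsto (fun N => ∑ n ∈ Finset.range (N + 1), w (N - n) * g n) atTop
      (𝓝 (α * ∑' n, g n)) := by
  obtain ⟨C, hC0, hC⟩ := exists_norm_le_of_tendsto hw
  have key := tendsto_tsum_of_dominated_convergence (𝓕 := atTop)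
    (f := fun N n => if n ∈ Finset.range (N + 1) then w (N - n) * g n else 0)
    (g := fun l => α * g l) (bound := fun l => C * ‖g l‖) (hg.norm.mul_left _) ?_ ?_
  · rw [tsum_mul_left] at key
    refine key.congr fun n => ?_
    rw [tsum_eq_sum (s := Finset.range (n + 1)) (fun l hl => if_neg hl)]
    exact Finset.sum_congr rfl fun l hl => if_pos hl
  · intro l
    refine ((hw.comp (tendsto_sub_atTop_nat l)).mul_const (g l)).congr' ?_
    filter_upwards [eventually_ge_atTop l] with n h3
    rw [if_pos (Finset.mem_range.mpr (by omega))]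
    rfl
  · refine Eventually.of_forall fun n l => ?_
    split_ifs
    · rw [norm_mul]
      gcongr
      exact hC _
    · rw [norm_zero]; positivity

lemma sum_range_eq_sum_Icc (s t : ℕ) (F : ℕ → ℂ) :
    ∑ k ∈ Finset.range (s + t + 1), F k
      = ∑ l ∈ Finset.Icc (-(s : ℤ)) t, F (s + l).toNat := by
  refine Finset.sum_bij' (fun k _ => (k : ℤ) - s) (fun l _ => (s + l).toNat) ?_ ?_ ?_ ?_ ?_
  · intro k hk; simp only [Finset.mem_range, Finset.mem_Icc] at *; omega
  · intro k hk; simp only [Finset.mem_range, Finset.mem_Icc] at *; omega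
  · intro k hk; simp only [Finset.mem_range] at *; omega
  · intro k hk; simp only [Finset.mem_Icc] at *; omega
  · intro k hk
    congr 1
    omega

end Limits

/-! ### Partial fractions by Lagrange interpolation. -/

section PartialFractions

open Polynomial

/-- The degree bound makes N equal to its Lagrange interpolant at the poles (c i)⁻¹; dividing that
by the full product leaves one simple fraction per pole. -/
lemma partial_fractions {ι : Type*} [DecidableEq ι] (s : Finset ι) (c : ι → ℂ)
    (hc : ∀ i ∈ s, c i ≠ 0) (inj : Set.InjOn c s) (N : ℂ[X]) (hN : N.degree < s.card) (y : ℂ)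
    (hy : ∀ i ∈ s, 1 - y * c i ≠ 0) :
    N.eval y / ∏ i ∈ s, (1 - y * c i)
      = ∑ i ∈ s, N.eval (c i)⁻¹ /
          ((∏ j ∈ s.erase i, (1 - (c i)⁻¹ * c j)) * (1 - y * c i)) := by
  have hinj : Set.InjOn (fun i => (c i)⁻¹) s := fun i hi j hj h => inj hi hj (inv_injective h)
  have h := congrArg (Polynomial.eval y) (Lagrange.eq_interpolate hinj hN)
  rw [Lagrange.interpolate_apply, Polynomial.eval_finsetSum] at h
  rw [h, Finset.sum_div]
  refine Finset.sum_congr rfl fun i hi => ?_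
  rw [eval_mul, eval_C, Lagrange.basis, eval_prod, ← Finset.mul_prod_erase s _ hi]
  have h1 : ∀ j ∈ s.erase i, eval y (Lagrange.basisDivisor (c i)⁻¹ (c j)⁻¹)
      = (1 - y * c j) / (1 - (c i)⁻¹ * c j) := by
    intro j hj
    have hjs := Finset.mem_of_mem_erase hj
    have hij : c i ≠ c j := fun h => Finset.ne_of_mem_erase hj (inj hjs hi h.symm)
    have hi0 := hc i hi
    have hj0 := hc j hjs
    have h2 : (c i)⁻¹ - (c j)⁻¹ ≠ 0 := sub_ne_zero.mpr fun h => hij (inv_injective h)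
    have h3 : 1 - (c i)⁻¹ * c j ≠ 0 := by
      intro h
      apply hij
      field_simp at h
      linear_combination h
    simp only [Lagrange.basisDivisor, eval_mul, eval_C, eval_sub, eval_X]
    rw [inv_mul_eq_div, div_eq_div_iff h2 h3]
    field_simp
    ring
  rw [Finset.prod_congr rfl h1, Finset.prod_div_distrib]
  have h4 : ∏ j ∈ s.erase i, (1 - y * c j) ≠ 0 :=
    Finset.prod_ne_zero_iff.mpr fun j hj => hy j (Finset.mem_of_mem_erase hj)
  have h5 := hy i hi
  field_simp

end PartialFractions

/-! ### Shifted finite products in base r². -/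

section FiniteProducts

variable {r : ℂ}

lemma norm_sq_lt_one (hr : ‖r‖ < 1) : ‖r ^ 2‖ < 1 := by
  rw [norm_pow]; exact pow_lt_one₀ (norm_nonneg _) hr two_ne_zero

lemma one_sub_pow_mul_div_ne_zero (hr0 : r ≠ 0) {x : ℂ} (hx0 : x ≠ 0)
    (hx : ∀ l : ℤ, 1 - x * (r ^ 2) ^ l ≠ 0) (i : ℕ) : 1 - (r ^ 2) ^ i * (r ^ 2 / x) ≠ 0 := by
  intro h
  apply hx (-(i + 1 : ℕ))
  rw [zpow_neg, zpow_natCast]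
  field_simp at h ⊢
  linear_combination -h

lemma one_sub_pow_mul_ne_zero' {x : ℂ} (hx : ∀ l : ℤ, 1 - x * (r ^ 2) ^ l ≠ 0) (i : ℕ) :
    1 - (r ^ 2) ^ i * x ≠ 0 := by
  have := hx i
  rwa [zpow_natCast, mul_comm] at this

/-- With P = r², each of the first s factors satisfies 1 - aP^{-j} = -aP^{-j}(1 - P^j/a); the
extracted powers of P multiply to r^{-s(s+1)}. -/
lemma qPoch_shift (hr0 : r ≠ 0) {a : ℂ} (ha : a ≠ 0) (s m : ℕ) :
    qPoch (a * ((r ^ 2) ^ s)⁻¹) (r ^ 2) (s + m)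
      = (-a) ^ s / r ^ (s * (s + 1)) * qPoch (r ^ 2 / a) (r ^ 2) s * qPoch a (r ^ 2) m := by
  induction s with
  | zero => simp [qPoch_zero]
  | succ s ih =>
    have h : r ^ 2 * (a * ((r ^ 2) ^ (s + 1))⁻¹) = a * ((r ^ 2) ^ s)⁻¹ := by
      field_simp
      ring
    rw [show s + 1 + m = (s + m) + 1 by ring, qPoch_succ', h, ih, qPoch_succ]
    have h2 : r ^ ((s + 1) * (s + 1 + 1)) = r ^ (s * (s + 1)) * ((r ^ 2) ^ (s + 1)) := by ring
    rw [h2]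
    field_simp
    ring

/-- This is the residue denominator at the pole P^{-k}, P = r². The factors j < k are reflected by
`qPoch_shift` at a = 1, and those with j > k already form a Pochhammer symbol. -/
lemma prod_erase_one_sub (hr0 : r ≠ 0) (k m : ℕ) :
    ∏ j ∈ (Finset.range (k + m + 1)).erase k, (1 - ((r ^ 2) ^ k)⁻¹ * (r ^ 2) ^ j)
      = (-1) ^ k / r ^ (k * (k + 1)) * qPoch (r ^ 2) (r ^ 2) k * qPoch (r ^ 2) (r ^ 2) m := by
  have h1 : ∏ j ∈ (Finset.range (k + m + 1)).erase k, (1 - ((r ^ 2) ^ k)⁻¹ * (r ^ 2) ^ j)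
      = ∏ j ∈ (Finset.range (k + m + 1)).erase k,
        (if j = k then 1 else (1 - ((r ^ 2) ^ k)⁻¹ * (r ^ 2) ^ j)) :=
    Finset.prod_congr rfl fun j hj => (if_neg (Finset.ne_of_mem_erase hj)).symm
  rw [h1, Finset.prod_erase _ (by simp), add_assoc, Finset.prod_range_add,
    Finset.prod_range_succ']
  have h2 := qPoch_shift hr0 one_ne_zero k 0
  simp only [add_zero, one_mul, qPoch_zero, mul_one, div_one] at h2
  rw [← h2]
  simp only [qPoch, add_zero, if_true, mul_one]
  congr 1
  · refine Finset.prod_congr rfl fun j hj => ?_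
    rw [if_neg (Finset.mem_range.mp hj).ne, mul_comm]
  · refine Finset.prod_congr rfl fun j hj => ?_
    rw [if_neg (by omega)]
    congr 1
    field_simp
    ring

lemma zpow_gaussian_sub (hr0 : r ≠ 0) (k s : ℕ) :
    r ^ (((k : ℤ) - s) ^ 2 + ((k : ℤ) - s))
      = r ^ (k * (k + 1)) * r ^ (s * s) / (r ^ (2 * k * s) * r ^ s) := by
  rw [eq_div_iff (by positivity)]
  simp only [← zpow_natCast, ← zpow_add₀ hr0]
  congr 1
  push_cast
  ring

lemma neg_one_zpow_sub (k s : ℕ) : (-1 : ℂ) ^ ((k : ℤ) - s) = (-1) ^ k * (-1) ^ s := by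
  rw [zpow_sub₀ (by norm_num), zpow_natCast, zpow_natCast, div_eq_mul_inv, ← inv_pow]
  norm_num

lemma sq_pow_injective (hr0 : r ≠ 0) (hr : ‖r‖ < 1) : Function.Injective fun k : ℕ => (r ^ 2) ^ k := by
  intro i j h
  have h1 := congrArg norm h
  simp only [norm_pow] at h1
  refine (pow_right_injective₀ (a := ‖r‖ ^ 2) (by positivity) ?_) h1
  exact (pow_lt_one₀ (norm_nonneg _) hr two_ne_zero).ne

end FiniteProducts

/-! ### Expansion of the reciprocal theta function. -/

section SinglePole

variable {r : ℂ}

lemma one_div_qPoch_mul_qPoch (hr0 : r ≠ 0) (hr : ‖r‖ < 1) {x : ℂ} (hx0 : x ≠ 0)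
    (hx : ∀ l : ℤ, 1 - x * (r ^ 2) ^ l ≠ 0) (s t : ℕ) :
    1 / (qPoch x (r ^ 2) (t + 1) * qPoch (r ^ 2 / x) (r ^ 2) s)
      = ∑ l ∈ Finset.Icc (-(s : ℤ)) t, (1 / qPoch (r ^ 2) (r ^ 2) (s + l).toNat) *
          (1 / qPoch (r ^ 2) (r ^ 2) (t - l).toNat) *
          ((-1) ^ l * r ^ (l ^ 2 + l) / (1 - x * (r ^ 2) ^ l)) := by
  have hP : ∀ n, qPoch (r ^ 2) (r ^ 2) n ≠ 0 := qPoch_self_ne_zero (norm_sq_lt_one hr)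
  have hshift : ∀ k : ℕ, x * ((r ^ 2) ^ s)⁻¹ * (r ^ 2) ^ k = x * (r ^ 2) ^ ((k : ℤ) - s) := by
    intro k
    rw [zpow_sub₀ (by positivity), zpow_natCast, zpow_natCast]
    ring
  -- The evaluation point xP^{-s}, P = r², centres the poles, with k = s + l. The numerator X^s
  -- contributes P^{-ks}, which completes the exponent k(k+1) of the residue to l² + l up to a
  -- factor depending only on s.
  have hpf := partial_fractions (Finset.range (s + t + 1)) (fun k => (r ^ 2) ^ k)
    (fun i _ => by positivity) ((sq_pow_injective hr0 hr).injOn) (Polynomial.X ^ s)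
    (by rw [Polynomial.degree_X_pow, Finset.card_range]; exact_mod_cast (by omega))
    (x * ((r ^ 2) ^ s)⁻¹) (fun k _ => by rw [hshift]; exact hx _)
  have hprod : ∏ k ∈ Finset.range (s + t + 1), (1 - x * ((r ^ 2) ^ s)⁻¹ * (r ^ 2) ^ k)
      = (-x) ^ s / r ^ (s * (s + 1)) * qPoch (r ^ 2 / x) (r ^ 2) s * qPoch x (r ^ 2) (t + 1) := by
    rw [← qPoch_shift hr0 hx0, qPoch, ← add_assoc]
    exact Finset.prod_congr rfl fun j _ => by ring
  have hne : ∏ k ∈ Finset.range (s + t + 1), (1 - x * ((r ^ 2) ^ s)⁻¹ * (r ^ 2) ^ k) ≠ 0 :=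
    Finset.prod_ne_zero_iff.mpr fun k _ => by rw [hshift]; exact hx _
  rw [hprod] at hpf hne
  have hA : qPoch (r ^ 2 / x) (r ^ 2) s ≠ 0 := fun h => hne (by rw [h]; ring)
  have hB : qPoch x (r ^ 2) (t + 1) ≠ 0 := fun h => hne (by rw [h]; ring)
  have hL : 1 / (qPoch x (r ^ 2) (t + 1) * qPoch (r ^ 2 / x) (r ^ 2) s)
      = (-1) ^ s * r ^ (s * s) / r ^ s * (Polynomial.eval (x * ((r ^ 2) ^ s)⁻¹) (Polynomial.X ^ s) /
        ((-x) ^ s / r ^ (s * (s + 1)) * qPoch (r ^ 2 / x) (r ^ 2) s *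
          qPoch x (r ^ 2) (t + 1))) := by
    rw [neg_pow x]
    have h1 : ((-1 : ℂ)) ^ s ≠ 0 := pow_ne_zero _ (by norm_num)
    have h2 : ((r ^ 2) ^ s) ^ s = r ^ (s * s) * r ^ (s * s) := by ring
    have h3 : r ^ (s * (s + 1)) = r ^ (s * s) * r ^ s := by ring
    simp only [Polynomial.eval_pow, Polynomial.eval_X, mul_pow, inv_pow, h2, h3]
    field_simp
  rw [hL, hpf, Finset.mul_sum, sum_range_eq_sum_Icc s t]
  refine Finset.sum_congr rfl fun l hl => ?_
  rw [Finset.mem_Icc] at hl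
  obtain ⟨k, hk⟩ : ∃ k : ℕ, (k : ℤ) = s + l := ⟨(s + l).toNat, by omega⟩
  obtain ⟨m, hm⟩ : ∃ m : ℕ, (m : ℤ) = t - l := ⟨(t - l).toNat, by omega⟩
  obtain rfl : l = (k : ℤ) - s := by omega
  rw [← hk, ← hm, Int.toNat_natCast, Int.toNat_natCast, show s + t + 1 = k + m + 1 by omega,
    prod_erase_one_sub hr0, hshift, zpow_gaussian_sub hr0, neg_one_zpow_sub]
  have h1 : ((-1 : ℂ)) ^ k ≠ 0 := pow_ne_zero _ (by norm_num)
  have h2 := hx (k - s)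
  have h3 := hP k
  have h4 := hP m
  have h5 : (-1 : ℂ) ^ k * (-1) ^ k = 1 := by rw [← mul_pow]; norm_num
  have h6 : ((r ^ 2) ^ k) ^ s = r ^ (2 * k * s) := by ring
  simp only [Polynomial.eval_pow, Polynomial.eval_X, inv_pow, h6]
  field_simp
  linear_combination -h5

theorem tsum_appell_one {x : ℂ} (hr0 : r ≠ 0) (hr : ‖r‖ < 1) (hx0 : x ≠ 0)
    (hx : ∀ l : ℤ, 1 - x * (r ^ 2) ^ l ≠ 0) :
    ∑' l : ℤ, (-1) ^ l * r ^ (l ^ 2 + l) / (1 - x * (r ^ 2) ^ l)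
      = qPochInf (r ^ 2) (r ^ 2) ^ 2 / (qPochInf x (r ^ 2) * qPochInf (r ^ 2 / x) (r ^ 2)) := by
  have hP := norm_sq_lt_one hr
  have hPI := qPochInf_self_ne_zero hP
  have hw : Tendsto (fun n => 1 / qPoch (r ^ 2) (r ^ 2) n) atTop
      (𝓝 (1 / qPochInf (r ^ 2) (r ^ 2))) :=
    tendsto_const_nhds.div (tendsto_qPoch hP _) hPI
  have hg : Summable fun l : ℤ => (-1) ^ l * r ^ (l ^ 2 + l) / (1 - x * (r ^ 2) ^ l) :=
    summable_appell hr0 hr (by positivity) hP (by norm_num) hx0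
  have h1 := tendsto_sum_Icc_weighted (s := fun n => n) (t := fun n => n) hw hw hg
    tendsto_id tendsto_id
  simp only [← one_div_qPoch_mul_qPoch hr0 hr hx0 hx] at h1
  have hx1 := one_sub_pow_mul_ne_zero' hx
  have hx2 := one_sub_pow_mul_div_ne_zero hr0 hx0 hx
  have h2 : Tendsto (fun n => 1 / (qPoch x (r ^ 2) (n + 1) * qPoch (r ^ 2 / x) (r ^ 2) n)) atTop
      (𝓝 (1 / (qPochInf x (r ^ 2) * qPochInf (r ^ 2 / x) (r ^ 2)))) :=
    tendsto_const_nhds.div (((tendsto_add_atTop_iff_nat 1).mpr (tendsto_qPoch hP x)).mul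
      (tendsto_qPoch hP _)) (mul_ne_zero (qPochInf_ne_zero hP hx1) (qPochInf_ne_zero hP hx2))
  have h3 := tendsto_nhds_unique h1 h2
  have h4 := qPochInf_ne_zero hP hx1
  have h5 := qPochInf_ne_zero hP hx2
  field_simp at h3 ⊢
  linear_combination h3

end SinglePole

/-! ### The q-binomial theorem and the Jacobi triple product. -/

section TripleProduct

variable {r : ℂ}

lemma qPoch_binomial (hr : ‖r‖ < 1) (y : ℂ) (N : ℕ) :
    qPoch (r ^ 2 * y) (r ^ 2) N = qPoch (r ^ 2) (r ^ 2) N *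
      ∑ k ∈ Finset.range (N + 1), (-1) ^ k * r ^ (k * (k + 1)) * y ^ k /
        (qPoch (r ^ 2) (r ^ 2) k * qPoch (r ^ 2) (r ^ 2) (N - k)) := by
  have hP : ∀ n, qPoch (r ^ 2) (r ^ 2) n ≠ 0 := qPoch_self_ne_zero (norm_sq_lt_one hr)
  induction N with
  | zero => simp [qPoch_zero]
  | succ N ih =>
    have hstep : ∀ k, k ≤ N → qPoch (r ^ 2) (r ^ 2) (N + 1 - k)
        = qPoch (r ^ 2) (r ^ 2) (N - k) * (1 - (r ^ 2) ^ (N - k) * r ^ 2) := by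
      intro k hk
      rw [show N + 1 - k = (N - k) + 1 by omega, qPoch_succ]
    have hfac : ∀ k : ℕ, 1 - r ^ 2 * (r ^ 2) ^ k ≠ 0 := fun k => by
      rw [mul_comm]
      exact one_sub_pow_mul_ne_zero (norm_sq_lt_one hr) (norm_sq_lt_one hr) k
    set f : ℕ → ℕ → ℂ := fun N k => (-1) ^ k * r ^ (k * (k + 1)) * y ^ k /
        (qPoch (r ^ 2) (r ^ 2) k * qPoch (r ^ 2) (r ^ 2) (N - k)) with hf
    -- The q-Pascal rule, from 1 - P^{N+1} = (1 - P^{N+1-k}) + P^{N+1-k}(1 - P^k) with P = r²: the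
    -- first piece reproduces the sum for N, the second does so after a shift of k.
    have key : (1 - (r ^ 2) ^ (N + 1)) * ∑ k ∈ Finset.range (N + 1 + 1), f (N + 1) k
        = (1 - (r ^ 2) ^ (N + 1) * y) * ∑ k ∈ Finset.range (N + 1), f N k := by
      have h1 : ∑ k ∈ Finset.range (N + 1 + 1), (1 - (r ^ 2) ^ (N + 1 - k)) * f (N + 1) k
          = ∑ k ∈ Finset.range (N + 1), f N k := by
        rw [Finset.sum_range_succ]
        simp only [Nat.sub_self, pow_zero, sub_self, zero_mul, add_zero]
        refine Finset.sum_congr rfl fun k hk => ?_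
        have hk' : k ≤ N := by simpa [Nat.lt_succ_iff] using hk
        have h2 := hP k
        have h3 := hP (N - k)
        have h4 := hfac (N - k)
        simp only [hf, hstep k hk']
        rw [show N + 1 - k = (N - k) + 1 by omega, pow_succ (r ^ 2) (N - k)]
        field_simp
      have h2 : ∑ k ∈ Finset.range (N + 1 + 1),
          (r ^ 2) ^ (N + 1 - k) * (1 - (r ^ 2) ^ k) * f (N + 1) k
          = -(r ^ 2) ^ (N + 1) * y * ∑ k ∈ Finset.range (N + 1), f N k := by
        rw [Finset.sum_range_succ', Finset.mul_sum]
        simp only [pow_zero, sub_self, mul_zero, zero_mul, add_zero]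
        refine Finset.sum_congr rfl fun k hk => ?_
        have hk' : k ≤ N := by simpa [Nat.lt_succ_iff] using hk
        have h2 := hP k
        have h3 := hP (N - k)
        have h4 := hfac k
        have h5 : (r ^ 2) ^ (N + 1) = (r ^ 2) ^ (N - k) * (r ^ 2) ^ (k + 1) := by
          rw [← pow_add]; congr 1; omega
        have h6 : r ^ ((k + 1) * (k + 1 + 1)) = r ^ (k * (k + 1)) * (r ^ 2) ^ (k + 1) := by ring
        simp only [hf, qPoch_succ, h5, h6]
        rw [show N + 1 - (k + 1) = N - k by omega, pow_succ (r ^ 2) k]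
        field_simp
        ring
      have h3 : (1 - (r ^ 2) ^ (N + 1)) * ∑ k ∈ Finset.range (N + 1 + 1), f (N + 1) k
          = ∑ k ∈ Finset.range (N + 1 + 1), (1 - (r ^ 2) ^ (N + 1 - k)) * f (N + 1) k
          + ∑ k ∈ Finset.range (N + 1 + 1),
            (r ^ 2) ^ (N + 1 - k) * (1 - (r ^ 2) ^ k) * f (N + 1) k := by
        rw [Finset.mul_sum, ← Finset.sum_add_distrib]
        refine Finset.sum_congr rfl fun k hk => ?_
        have hk' : k ≤ N + 1 := by simpa [Nat.lt_succ_iff] using hk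
        have h5 : (r ^ 2) ^ (N + 1) = (r ^ 2) ^ (N + 1 - k) * (r ^ 2) ^ k := by
          rw [← pow_add]; congr 1; omega
        rw [h5]
        ring
      rw [h3, h1, h2]
      ring
    rw [qPoch_succ, qPoch_succ, ih]
    rw [show (r ^ 2) ^ N * (r ^ 2) = (r ^ 2) ^ (N + 1) by ring,
      show (r ^ 2) ^ N * (r ^ 2 * y) = (r ^ 2) ^ (N + 1) * y by ring]
    linear_combination (-qPoch (r ^ 2) (r ^ 2) N) * key

/-- The q-binomial theorem with 2n factors at y = cP^{-n}, P = r², recentred by k = n + l. -/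
lemma qPoch_triple_product (hr0 : r ≠ 0) (hr : ‖r‖ < 1) {c : ℂ} (hc : c ≠ 0) (n : ℕ) :
    qPoch (1 / c) (r ^ 2) n * qPoch (r ^ 2 * c) (r ^ 2) n = qPoch (r ^ 2) (r ^ 2) (n + n) *
      ∑ l ∈ Finset.Icc (-(n : ℤ)) n, (1 / qPoch (r ^ 2) (r ^ 2) (n + l).toNat) *
          (1 / qPoch (r ^ 2) (r ^ 2) (n - l).toNat) *
          ((-c) ^ l * r ^ (l ^ 2 + l)) := by
  have hP : ∀ n, qPoch (r ^ 2) (r ^ 2) n ≠ 0 := qPoch_self_ne_zero (norm_sq_lt_one hr)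
  have h1 := qPoch_shift hr0 (mul_ne_zero (pow_ne_zero 2 hr0) hc) n n
  have h2 : r ^ 2 / (r ^ 2 * c) = 1 / c := by field_simp
  rw [h2, mul_assoc (r ^ 2) c, qPoch_binomial hr] at h1
  have h3 : qPoch (1 / c) (r ^ 2) n * qPoch (r ^ 2 * c) (r ^ 2) n
      = ((-(r ^ 2 * c)) ^ n / r ^ (n * (n + 1)))⁻¹ * ((-(r ^ 2 * c)) ^ n / r ^ (n * (n + 1)) *
        qPoch (1 / c) (r ^ 2) n * qPoch (r ^ 2 * c) (r ^ 2) n) := by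
    have : (-(r ^ 2 * c)) ^ n ≠ 0 := pow_ne_zero _ (neg_ne_zero.mpr (by positivity))
    field_simp
  rw [h3, ← h1, mul_left_comm, Finset.mul_sum, sum_range_eq_sum_Icc n n]
  congr 1
  refine Finset.sum_congr rfl fun l hl => ?_
  rw [Finset.mem_Icc] at hl
  obtain ⟨k, hk⟩ : ∃ k : ℕ, (k : ℤ) = n + l := ⟨(n + l).toNat, by omega⟩
  obtain ⟨m, hm⟩ : ∃ m : ℕ, (m : ℤ) = n - l := ⟨(n - l).toNat, by omega⟩
  obtain rfl : l = (k : ℤ) - n := by omega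
  rw [← hk, ← hm, Int.toNat_natCast, Int.toNat_natCast, show n + n - k = m by omega,
    zpow_gaussian_sub hr0, neg_eq_neg_one_mul c, mul_zpow, neg_one_zpow_sub, zpow_sub₀ hc,
    zpow_natCast, zpow_natCast, neg_eq_neg_one_mul (r ^ 2 * c), mul_pow (-1 : ℂ)]
  have h1 : ((-1 : ℂ)) ^ n ≠ 0 := pow_ne_zero _ (by norm_num)
  have h3 := hP k
  have h4 := hP m
  have h5 : (-1 : ℂ) ^ n * (-1) ^ n = 1 := by rw [← mul_pow]; norm_num
  have h6 : ((r ^ 2) ^ n) ^ k = r ^ (2 * k * n) := by ring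
  have h7 : r ^ (n * (n + 1)) = r ^ (n * n) * r ^ n := by ring
  have h8 : (r ^ 2 * c) ^ n = r ^ n * r ^ n * c ^ n := by ring
  simp only [mul_pow c, inv_pow, h6, h7, h8]
  field_simp
  linear_combination -h5

theorem tsum_triple_product (hr0 : r ≠ 0) (hr : ‖r‖ < 1) {c : ℂ} (hc : c ≠ 0) :
    ∑' l : ℤ, (-c) ^ l * r ^ (l ^ 2 + l)
      = qPochInf (r ^ 2) (r ^ 2) * qPochInf (1 / c) (r ^ 2) * qPochInf (r ^ 2 * c) (r ^ 2) := by
  have hP := norm_sq_lt_one hr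
  have hPI := qPochInf_self_ne_zero hP
  have hw : Tendsto (fun n => 1 / qPoch (r ^ 2) (r ^ 2) n) atTop
      (𝓝 (1 / qPochInf (r ^ 2) (r ^ 2))) :=
    tendsto_const_nhds.div (tendsto_qPoch hP _) hPI
  have h1 := tendsto_sum_Icc_weighted (s := fun n => n) (t := fun n => n) hw hw
    (summable_zpow_mul_gaussian hr0 hr (-c) (neg_ne_zero.mpr hc)) tendsto_id tendsto_id
  have h2 := ((tendsto_qPoch hP (r ^ 2)).comp
    (tendsto_atTop_mono (fun n => Nat.le_add_left n n) tendsto_id)).mul h1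
  simp only [Function.comp_apply, ← qPoch_triple_product hr0 hr hc] at h2
  have h3 := tendsto_nhds_unique h2 ((tendsto_qPoch hP (1 / c)).mul (tendsto_qPoch hP (r ^ 2 * c)))
  field_simp at h3 ⊢
  linear_combination h3

end TripleProduct

/-! ### Partial fractions of a theta quotient with two families of poles. -/

section TwoPoles

variable {r : ℂ}

/-- `(P/β; P)_k / ((P/β²; P)_k (P; P)_k)`. -/
noncomputable def poleWeight (β P : ℂ) (k : ℕ) : ℂ :=
  qPoch (P / β) P k / (qPoch (P / β ^ 2) P k * qPoch P P k)

/-- `(β; P)_{m+1} / ((β²; P)_{m+1} (P; P)_m)`. -/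
noncomputable def poleWeight' (β P : ℂ) (m : ℕ) : ℂ :=
  qPoch β P (m + 1) / (qPoch (β ^ 2) P (m + 1) * qPoch P P m)

lemma mul_inv_pow_mul_pow (hr0 : r ≠ 0) (x : ℂ) (n k : ℕ) :
    x * ((r ^ 2) ^ n)⁻¹ * (r ^ 2) ^ k = x * (r ^ 2) ^ ((k : ℤ) - n) := by
  rw [zpow_sub₀ (by positivity), zpow_natCast, zpow_natCast]
  ring

lemma prod_range_eq_qPoch_shift (hr0 : r ≠ 0) {x : ℂ} (hx : x ≠ 0) {k m n : ℕ}
    (h : k + m = n + n) :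
    ∏ j ∈ Finset.range (n + n + 1), (1 - x * ((r ^ 2) ^ k)⁻¹ * (r ^ 2) ^ j)
      = (-x) ^ k / r ^ (k * (k + 1)) * qPoch (r ^ 2 / x) (r ^ 2) k * qPoch x (r ^ 2) (m + 1) := by
  rw [← qPoch_shift hr0 hx, qPoch, ← add_assoc, h]
  exact Finset.prod_congr rfl fun j _ => by ring

/-- The contribution of the nodes β⁻¹P^k, P = r², to the expansion below; exchanging β and β⁻¹ gives
the other family. The prefactor absorbs the powers of r left over when the exponent is centred. -/
lemma sum_pole_family (hr0 : r ≠ 0) (hr : ‖r‖ < 1) {β z : ℂ} (hβ0 : β ≠ 0)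
    (hβ : ∀ l : ℤ, 1 - β ^ 2 * (r ^ 2) ^ l ≠ 0)
    (hz : ∀ l : ℤ, 1 - z * β⁻¹ * (r ^ 2) ^ l ≠ 0) (n : ℕ) :
    (-1) ^ n * r ^ (n * n) / r ^ n * ∑ k ∈ Finset.range (n + n + 1),
      (((β⁻¹ * (r ^ 2) ^ k)⁻¹) ^ n *
        ∏ j ∈ Finset.range (n + n + 1), (1 - (β⁻¹ * (r ^ 2) ^ k)⁻¹ * (r ^ 2) ^ j)) /
      (((∏ j ∈ (Finset.range (n + n + 1)).erase k,
          (1 - (β⁻¹ * (r ^ 2) ^ k)⁻¹ * (β⁻¹ * (r ^ 2) ^ j))) *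
        ∏ j ∈ Finset.range (n + n + 1), (1 - (β⁻¹ * (r ^ 2) ^ k)⁻¹ * (β * (r ^ 2) ^ j))) *
        (1 - z * ((r ^ 2) ^ n)⁻¹ * (β⁻¹ * (r ^ 2) ^ k)))
      = ∑ l ∈ Finset.Icc (-(n : ℤ)) n, poleWeight β (r ^ 2) (n + l).toNat *
          poleWeight' β (r ^ 2) (n - l).toNat *
          ((-β⁻¹) ^ l * r ^ (l ^ 2 + l) / (1 - z * β⁻¹ * (r ^ 2) ^ l)) := by
  have hP : ∀ n, qPoch (r ^ 2) (r ^ 2) n ≠ 0 := qPoch_self_ne_zero (norm_sq_lt_one hr)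
  have hb1 := qPoch_ne_zero (one_sub_pow_mul_ne_zero' hβ)
  have hb2 := qPoch_ne_zero (one_sub_pow_mul_div_ne_zero hr0 (pow_ne_zero 2 hβ0) hβ)
  rw [Finset.mul_sum, sum_range_eq_sum_Icc n n]
  refine Finset.sum_congr rfl fun l hl => ?_
  rw [Finset.mem_Icc] at hl
  obtain ⟨k, hk⟩ : ∃ k : ℕ, (k : ℤ) = n + l := ⟨(n + l).toNat, by omega⟩
  obtain ⟨m, hm⟩ : ∃ m : ℕ, (m : ℤ) = n - l := ⟨(n - l).toNat, by omega⟩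
  obtain rfl : l = (k : ℤ) - n := by omega
  have hkm : k + m = n + n := by omega
  rw [← hk, ← hm, Int.toNat_natCast, Int.toNat_natCast]
  have e1 : ∏ j ∈ Finset.range (n + n + 1), (1 - (β⁻¹ * (r ^ 2) ^ k)⁻¹ * (r ^ 2) ^ j)
      = (-β) ^ k / r ^ (k * (k + 1)) * qPoch (r ^ 2 / β) (r ^ 2) k * qPoch β (r ^ 2) (m + 1) := by
    rw [← prod_range_eq_qPoch_shift hr0 hβ0 hkm]
    exact Finset.prod_congr rfl fun j _ => by rw [mul_inv, inv_inv]
  have e2 : ∏ j ∈ Finset.range (n + n + 1), (1 - (β⁻¹ * (r ^ 2) ^ k)⁻¹ * (β * (r ^ 2) ^ j))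
      = (-β ^ 2) ^ k / r ^ (k * (k + 1)) * qPoch (r ^ 2 / β ^ 2) (r ^ 2) k *
        qPoch (β ^ 2) (r ^ 2) (m + 1) := by
    rw [← prod_range_eq_qPoch_shift hr0 (pow_ne_zero 2 hβ0) hkm]
    exact Finset.prod_congr rfl fun j _ => by rw [mul_inv, inv_inv]; ring
  have e3 : ∏ j ∈ (Finset.range (n + n + 1)).erase k,
      (1 - (β⁻¹ * (r ^ 2) ^ k)⁻¹ * (β⁻¹ * (r ^ 2) ^ j))
      = (-1) ^ k / r ^ (k * (k + 1)) * qPoch (r ^ 2) (r ^ 2) k * qPoch (r ^ 2) (r ^ 2) m := by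
    rw [← prod_erase_one_sub hr0, hkm]
    refine Finset.prod_congr rfl fun j _ => ?_
    rw [mul_inv, inv_inv]
    field_simp
  have e4 : z * ((r ^ 2) ^ n)⁻¹ * (β⁻¹ * (r ^ 2) ^ k) = z * β⁻¹ * (r ^ 2) ^ ((k : ℤ) - n) := by
    rw [← mul_inv_pow_mul_pow hr0]
    ring
  rw [e1, e2, e3, e4, zpow_gaussian_sub hr0, neg_eq_neg_one_mul β⁻¹, mul_zpow, neg_one_zpow_sub,
    zpow_sub₀ (inv_ne_zero hβ0), zpow_natCast, zpow_natCast, poleWeight, poleWeight',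
    neg_pow β, neg_pow (β ^ 2)]
  have h1 : (-1 : ℂ) ^ k ≠ 0 := pow_ne_zero _ (by norm_num)
  have h2 := hz (k - n)
  have h3 := hP k
  have h4 := hP m
  have h5 : (-1 : ℂ) ^ k * (-1) ^ k = 1 := by rw [← mul_pow]; norm_num
  have h6 : ((r ^ 2) ^ k) ^ n = r ^ (2 * k * n) := by ring
  have h7 : (β ^ 2) ^ k = β ^ k * β ^ k := by ring
  have h8 := hb1 (m + 1)
  have h9 := hb2 k
  generalize 1 - z * β⁻¹ * (r ^ 2) ^ ((k : ℤ) - n) = den at h2 ⊢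
  generalize qPoch (r ^ 2 / β ^ 2) (r ^ 2) k = u1 at h9 ⊢
  generalize qPoch (β ^ 2) (r ^ 2) (m + 1) = u2 at h8 ⊢
  generalize qPoch (r ^ 2 / β) (r ^ 2) k = u3
  simp only [mul_inv, inv_pow, inv_inv, mul_pow, h6, h7]
  field_simp
  linear_combination -(u3 * qPoch β (r ^ 2) (m + 1)) * h5

lemma disjSum_erase_inl (s t : Finset ℕ) (k : ℕ) :
    (s.disjSum t).erase (Sum.inl k) = (s.erase k).disjSum t := by
  ext (i | i) <;> simp

lemma disjSum_erase_inr (s t : Finset ℕ) (k : ℕ) :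
    (s.disjSum t).erase (Sum.inr k) = s.disjSum (t.erase k) := by
  ext (i | i) <;> simp

open Polynomial in
-- A finite form of the change-of-parameter formula for Appell sums: in the limit, a theta quotient
-- in z, zβ and zβ⁻¹ links a sum with poles governed by zβ to one governed by zβ⁻¹.
lemma qPoch_quotient_eq_sum (hr0 : r ≠ 0) (hr : ‖r‖ < 1) {β z : ℂ} (hβ0 : β ≠ 0) (hz0 : z ≠ 0)
    (hβ : ∀ l : ℤ, 1 - β ^ 2 * (r ^ 2) ^ l ≠ 0)
    (hz : ∀ l : ℤ, 1 - z * β * (r ^ 2) ^ l ≠ 0)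
    (hz' : ∀ l : ℤ, 1 - z * β⁻¹ * (r ^ 2) ^ l ≠ 0) (n : ℕ) :
    qPoch z (r ^ 2) (n + 1) * qPoch (r ^ 2 / z) (r ^ 2) n /
      (qPoch (z * β⁻¹) (r ^ 2) (n + 1) * qPoch (r ^ 2 / (z * β⁻¹)) (r ^ 2) n *
        (qPoch (z * β) (r ^ 2) (n + 1) * qPoch (r ^ 2 / (z * β)) (r ^ 2) n))
      = ∑ l ∈ Finset.Icc (-(n : ℤ)) n, poleWeight β (r ^ 2) (n + l).toNat *
          poleWeight' β (r ^ 2) (n - l).toNat *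
          ((-β⁻¹) ^ l * r ^ (l ^ 2 + l) / (1 - z * β⁻¹ * (r ^ 2) ^ l))
      + ∑ l ∈ Finset.Icc (-(n : ℤ)) n, poleWeight β⁻¹ (r ^ 2) (n + l).toNat *
          poleWeight' β⁻¹ (r ^ 2) (n - l).toNat *
          ((-β) ^ l * r ^ (l ^ 2 + l) / (1 - z * β * (r ^ 2) ^ l)) := by
  have hzβ : z * β ≠ 0 := mul_ne_zero hz0 hβ0
  have hzβ' : z * β⁻¹ ≠ 0 := mul_ne_zero hz0 (inv_ne_zero hβ0)
  have hβ' : ∀ l : ℤ, 1 - β⁻¹ ^ 2 * (r ^ 2) ^ l ≠ 0 := fun l h => by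
    apply hβ (-l)
    have h1 : (r ^ 2) ^ l ≠ 0 := zpow_ne_zero _ (by positivity)
    rw [zpow_neg]
    field_simp at h ⊢
    linear_combination -h
  have hs1 := sum_pole_family hr0 hr hβ0 hβ hz' n
  have hs2 := sum_pole_family hr0 hr (inv_ne_zero hβ0) hβ' (z := z) (by simpa using hz) n
  simp only [inv_inv] at hs2
  set R := Finset.range (n + n + 1) with hR
  set c : ℕ ⊕ ℕ → ℂ := Sum.elim (fun k => β⁻¹ * (r ^ 2) ^ k) (fun k => β * (r ^ 2) ^ k) with hc
  set N : ℂ[X] := X ^ n * ∏ j ∈ R, (1 - X * C ((r ^ 2) ^ j)) with hN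
  have heval : ∀ y, N.eval y = y ^ n * ∏ j ∈ R, (1 - y * (r ^ 2) ^ j) := fun y => by
    simp [hN, eval_prod]
  -- The degree is at most 3n + 1, against 4n + 2 nodes.
  have hdeg : N.degree < (R.disjSum R).card := by
    have h1 : N.natDegree ≤ n + R.card * 1 := by
      refine natDegree_mul_le.trans (add_le_add (natDegree_X_pow_le n) ?_)
      refine (natDegree_prod_le _ _).trans (Finset.sum_le_card_nsmul _ _ _ fun j _ => ?_)
      refine (natDegree_sub_le _ _).trans (max_le (by simp) ?_)
      exact (natDegree_mul_C_le _ _).trans natDegree_X_le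
    refine degree_le_natDegree.trans_lt ?_
    rw [Finset.card_disjSum]
    rw [hR, Finset.card_range] at h1 ⊢
    exact_mod_cast (by omega)
  have hc0 : ∀ i ∈ R.disjSum R, c i ≠ 0 := by
    rintro (i | i) _
    · exact mul_ne_zero (inv_ne_zero hβ0) (by positivity)
    · exact mul_ne_zero hβ0 (by positivity)
  -- The two families cannot meet, since a common node would make β² an integral power of r².
  have hinr : ∀ i j : ℕ, β⁻¹ * (r ^ 2) ^ i ≠ β * (r ^ 2) ^ j := fun i j h => by
    apply hβ (j - i)
    rw [zpow_sub₀ (by positivity), zpow_natCast, zpow_natCast]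
    field_simp at h ⊢
    linear_combination h
  have hinj : Set.InjOn c (R.disjSum R) := by
    rintro (i | i) _ (j | j) _ h
    · exact congrArg _ (sq_pow_injective hr0 hr (mul_left_cancel₀ (inv_ne_zero hβ0) h))
    · exact absurd h (hinr i j)
    · exact absurd h.symm (hinr j i)
    · exact congrArg _ (sq_pow_injective hr0 hr (mul_left_cancel₀ hβ0 h))
  have hy : ∀ i ∈ R.disjSum R, 1 - z * ((r ^ 2) ^ n)⁻¹ * c i ≠ 0 := by
    rintro (i | i) _
    · have := hz' (i - n)
      rw [← mul_inv_pow_mul_pow hr0] at this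
      convert this using 2
      simp only [hc, Sum.elim_inl]; ring
    · have := hz (i - n)
      rw [← mul_inv_pow_mul_pow hr0] at this
      convert this using 2
      simp only [hc, Sum.elim_inr]; ring
  have hpf := partial_fractions (R.disjSum R) c hc0 hinj N hdeg (z * ((r ^ 2) ^ n)⁻¹) hy
  have hne := Finset.prod_ne_zero_iff.mpr hy
  rw [Finset.prod_disjSum] at hne
  rw [Finset.sum_disjSum, Finset.prod_disjSum] at hpf
  simp only [disjSum_erase_inl, disjSum_erase_inr, Finset.prod_disjSum, heval] at hpf
  simp only [hc, Sum.elim_inl, Sum.elim_inr] at hpf hne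
  have e1 : ∏ j ∈ R, (1 - z * ((r ^ 2) ^ n)⁻¹ * (β⁻¹ * (r ^ 2) ^ j))
      = (-(z * β⁻¹)) ^ n / r ^ (n * (n + 1)) * qPoch (r ^ 2 / (z * β⁻¹)) (r ^ 2) n *
        qPoch (z * β⁻¹) (r ^ 2) (n + 1) := by
    rw [← prod_range_eq_qPoch_shift hr0 hzβ' rfl]
    exact Finset.prod_congr rfl fun j _ => by ring
  have e2 : ∏ j ∈ R, (1 - z * ((r ^ 2) ^ n)⁻¹ * (β * (r ^ 2) ^ j))
      = (-(z * β)) ^ n / r ^ (n * (n + 1)) * qPoch (r ^ 2 / (z * β)) (r ^ 2) n *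
        qPoch (z * β) (r ^ 2) (n + 1) := by
    rw [← prod_range_eq_qPoch_shift hr0 hzβ rfl]
    exact Finset.prod_congr rfl fun j _ => by ring
  have e3 := prod_range_eq_qPoch_shift hr0 hz0 (rfl : n + n = n + n)
  rw [← hs1, ← hs2, ← mul_add]
  conv_rhs at hpf => rw [add_comm]
  rw [e1, e2, e3] at hpf
  rw [e1, e2] at hne
  have hA : qPoch (r ^ 2 / (z * β⁻¹)) (r ^ 2) n ≠ 0 := fun h => hne (by rw [h]; ring)
  have hB : qPoch (z * β⁻¹) (r ^ 2) (n + 1) ≠ 0 := fun h => hne (by rw [h]; ring)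
  have hC : qPoch (r ^ 2 / (z * β)) (r ^ 2) n ≠ 0 := fun h => hne (by rw [h]; ring)
  have hD : qPoch (z * β) (r ^ 2) (n + 1) ≠ 0 := fun h => hne (by rw [h]; ring)
  generalize qPoch (r ^ 2 / (z * β⁻¹)) (r ^ 2) n = u1 at *
  generalize qPoch (z * β⁻¹) (r ^ 2) (n + 1) = u2 at *
  generalize qPoch (r ^ 2 / (z * β)) (r ^ 2) n = u3 at *
  generalize qPoch (z * β) (r ^ 2) (n + 1) = u4 at *
  generalize qPoch (r ^ 2 / z) (r ^ 2) n = u5 at *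
  have hL : qPoch z (r ^ 2) (n + 1) * u5 / (u2 * u1 * (u4 * u3))
      = (-1) ^ n * r ^ (n * n) / r ^ n * ((z * ((r ^ 2) ^ n)⁻¹) ^ n *
        ((-z) ^ n / r ^ (n * (n + 1)) * u5 * qPoch z (r ^ 2) (n + 1)) /
        ((-(z * β⁻¹)) ^ n / r ^ (n * (n + 1)) * u1 * u2 *
          ((-(z * β)) ^ n / r ^ (n * (n + 1)) * u3 * u4))) := by
    have h1 : (-1 : ℂ) ^ n ≠ 0 := pow_ne_zero _ (by norm_num)
    have h2 : ((r ^ 2) ^ n) ^ n = r ^ (n * n) * r ^ (n * n) := by ring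
    have h3 : r ^ (n * (n + 1)) = r ^ (n * n) * r ^ n := by ring
    simp only [neg_pow z, neg_pow (z * β⁻¹), neg_pow (z * β), mul_pow, inv_pow, h2, h3]
    field_simp
  rw [hL, hpf]
  congr 1
  rw [add_comm]
  congr 1
  refine Finset.sum_congr rfl fun k _ => ?_
  congr 2
  rw [mul_comm]

lemma tendsto_poleWeight (hr0 : r ≠ 0) (hr : ‖r‖ < 1) {β : ℂ} (hβ0 : β ≠ 0)
    (hβ : ∀ l : ℤ, 1 - β ^ 2 * (r ^ 2) ^ l ≠ 0) :
    Tendsto (poleWeight β (r ^ 2)) atTop (𝓝 (qPochInf (r ^ 2 / β) (r ^ 2) /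
      (qPochInf (r ^ 2 / β ^ 2) (r ^ 2) * qPochInf (r ^ 2) (r ^ 2)))) := by
  have hP := norm_sq_lt_one hr
  exact (tendsto_qPoch hP _).div ((tendsto_qPoch hP _).mul (tendsto_qPoch hP _))
    (mul_ne_zero (qPochInf_ne_zero hP (one_sub_pow_mul_div_ne_zero hr0 (pow_ne_zero 2 hβ0) hβ))
      (qPochInf_self_ne_zero hP))

lemma tendsto_poleWeight' (hr : ‖r‖ < 1) {β : ℂ}
    (hβ : ∀ l : ℤ, 1 - β ^ 2 * (r ^ 2) ^ l ≠ 0) :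
    Tendsto (poleWeight' β (r ^ 2)) atTop (𝓝 (qPochInf β (r ^ 2) /
      (qPochInf (β ^ 2) (r ^ 2) * qPochInf (r ^ 2) (r ^ 2)))) := by
  have hP := norm_sq_lt_one hr
  exact ((tendsto_add_atTop_iff_nat 1).mpr (tendsto_qPoch hP _)).div
    (((tendsto_add_atTop_iff_nat 1).mpr (tendsto_qPoch hP _)).mul (tendsto_qPoch hP _))
    (mul_ne_zero (qPochInf_ne_zero hP (one_sub_pow_mul_ne_zero' hβ)) (qPochInf_self_ne_zero hP))

end TwoPoles

/-! ### A Bailey-type transformation of the universal mock theta series. -/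

section Bailey

variable {r : ℂ}

/-- The Durfee rectangle identity, a case of q-Chu–Vandermonde. With P = r², write 1 - P^{M+1} =
P^m(1 - P^{M+1-m}) + (1 - P^m); term m of the first piece and term m + 1 of the second combine into
a term of the sum for (M, a + 1), so the induction must let a vary. -/
lemma sum_durfee (hr : ‖r‖ < 1) (M a : ℕ) :
    ∑ m ∈ Finset.range (M + 1), (r ^ 2) ^ (m * (m + a)) / (qPoch (r ^ 2) (r ^ 2) (M - m) *
        qPoch (r ^ 2) (r ^ 2) m * qPoch (r ^ 2) (r ^ 2) (m + a))
      = 1 / (qPoch (r ^ 2) (r ^ 2) M * qPoch (r ^ 2) (r ^ 2) (M + a)) := by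
  have hP : ∀ n, qPoch (r ^ 2) (r ^ 2) n ≠ 0 := qPoch_self_ne_zero (norm_sq_lt_one hr)
  have hfac : ∀ k : ℕ, 1 - r ^ 2 * (r ^ 2) ^ k ≠ 0 := fun k => by
    rw [mul_comm]
    exact one_sub_pow_mul_ne_zero (norm_sq_lt_one hr) (norm_sq_lt_one hr) k
  have hsucc : ∀ k, qPoch (r ^ 2) (r ^ 2) (k + 1)
      = qPoch (r ^ 2) (r ^ 2) k * (1 - r ^ 2 * (r ^ 2) ^ k) := fun k => by
    rw [qPoch_succ, mul_comm (r ^ 2) ((r ^ 2) ^ k)]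
  induction M generalizing a with
  | zero => simp [qPoch_zero]
  | succ M ih =>
    set f : ℕ → ℂ := fun m => (r ^ 2) ^ (m * (m + a)) / (qPoch (r ^ 2) (r ^ 2) (M + 1 - m) *
        qPoch (r ^ 2) (r ^ 2) m * qPoch (r ^ 2) (r ^ 2) (m + a)) with hf
    have h1 : (1 - r ^ 2 * (r ^ 2) ^ M) * ∑ m ∈ Finset.range (M + 1 + 1), f m
        = ∑ m ∈ Finset.range (M + 1 + 1), (r ^ 2) ^ m * (1 - (r ^ 2) ^ (M + 1 - m)) * f m
        + ∑ m ∈ Finset.range (M + 1 + 1), (1 - (r ^ 2) ^ m) * f m := by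
      rw [Finset.mul_sum, ← Finset.sum_add_distrib]
      refine Finset.sum_congr rfl fun m hm => ?_
      have hm' : m ≤ M + 1 := by simpa [Nat.lt_succ_iff] using hm
      have h5 : r ^ 2 * (r ^ 2) ^ M = (r ^ 2) ^ m * (r ^ 2) ^ (M + 1 - m) := by
        rw [← pow_add, ← pow_succ']; congr 1; omega
      rw [h5]
      ring
    have h2 := ih (a + 1)
    rw [Finset.sum_range_succ
        (fun m => (r ^ 2) ^ m * (1 - (r ^ 2) ^ (M + 1 - m)) * f m),
      Finset.sum_range_succ' (fun m => (1 - (r ^ 2) ^ m) * f m)] at h1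
    simp only [Nat.sub_self, pow_zero, sub_self, mul_zero, zero_mul, add_zero] at h1
    rw [← Finset.sum_add_distrib] at h1
    have h3 : ∀ m ∈ Finset.range (M + 1), (r ^ 2) ^ m * (1 - (r ^ 2) ^ (M + 1 - m)) * f m +
        (1 - (r ^ 2) ^ (m + 1)) * f (m + 1)
        = (r ^ 2) ^ (m * (m + (a + 1))) / (qPoch (r ^ 2) (r ^ 2) (M - m) *
        qPoch (r ^ 2) (r ^ 2) m * qPoch (r ^ 2) (r ^ 2) (m + (a + 1))) := by
      intro m hm
      have hm' : m ≤ M := by simpa [Nat.lt_succ_iff] using hm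
      have e1 : (r ^ 2) ^ ((m + 1) * (m + 1 + a))
          = (r ^ 2) ^ (m * (m + a)) * (r ^ 2) ^ m * (r ^ 2 * (r ^ 2) ^ (m + a)) := by ring
      have e2 : (r ^ 2) ^ (m * (m + (a + 1))) = (r ^ 2) ^ (m * (m + a)) * (r ^ 2) ^ m := by ring
      simp only [hf]
      rw [show M + 1 - m = (M - m) + 1 by omega, show M + 1 - (m + 1) = M - m by omega,
        show m + 1 + a = (m + a) + 1 by ring, show m + (a + 1) = (m + a) + 1 by ring,
        hsucc, hsucc, hsucc, pow_succ' _ (M - m), pow_succ' _ m]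
      rw [show m + 1 + a = (m + a) + 1 by ring] at e1
      rw [show m + (a + 1) = (m + a) + 1 by ring] at e2
      rw [e1, e2]
      have g1 := hP (M - m)
      have g2 := hP m
      have g3 := hP (m + a)
      have g4 := hfac (M - m)
      have g5 := hfac m
      have g6 := hfac (m + a)
      generalize 1 - r ^ 2 * (r ^ 2) ^ (M - m) = v1 at *
      generalize 1 - r ^ 2 * (r ^ 2) ^ m = v2 at *
      generalize (r ^ 2) ^ (m + a) = v3 at *
      generalize qPoch (r ^ 2) (r ^ 2) (M - m) = v4 at *
      field_simp
      ring
    rw [Finset.sum_congr rfl h3, h2] at h1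
    have g1 := hP M
    have g2 := hP (M + (a + 1))
    have g3 := hfac M
    rw [show M + 1 + a = M + (a + 1) by ring, hsucc]
    field_simp at h1 ⊢
    linear_combination h1

/-- For n = a + m one has 2n(n+1) = 2a(a+1) + 2m(m+2a+1), so this is the Durfee identity with shift
2a + 1. -/
lemma sum_bailey_coeff (hr : ‖r‖ < 1) {a N : ℕ} (ha : a ≤ N) :
    ∑ n ∈ Finset.range (N + 1), (if a ≤ n then 1 / qPoch (r ^ 2) (r ^ 2) (N - n) *
        r ^ (2 * n * (n + 1)) * (1 / qPoch (r ^ 2) (r ^ 2) (n + 1 + a)) *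
        (1 / qPoch (r ^ 2) (r ^ 2) (n - a)) else 0)
      = r ^ (2 * a * (a + 1)) * (1 / qPoch (r ^ 2) (r ^ 2) (N + 1 + a)) *
        (1 / qPoch (r ^ 2) (r ^ 2) (N - a)) := by
  obtain ⟨M, rfl⟩ := Nat.exists_eq_add_of_le ha
  rw [add_assoc a M 1, Finset.sum_range_add, Finset.sum_eq_zero, zero_add]
  · have h := sum_durfee hr M (2 * a + 1)
    rw [show a + M - a = M by omega, show a + (M + 1) + a = M + (2 * a + 1) by ring, mul_assoc,
      one_div_mul_one_div_rev, ← h, Finset.mul_sum]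
    refine Finset.sum_congr rfl fun m _ => ?_
    rw [if_pos (by omega), show a + M - (a + m) = M - m by omega, show a + m - a = m by omega,
      show a + m + 1 + a = m + (2 * a + 1) by ring,
      show r ^ (2 * (a + m) * (a + m + 1))
        = r ^ (2 * a * (a + 1)) * (r ^ 2) ^ (m * (m + (2 * a + 1))) by ring]
    ring
  · intro n hn
    rw [if_neg (by simpa using hn)]

lemma zpow_cube_gaussian (hr0 : r ≠ 0) (l : ℤ) (a : ℕ) (h : l ^ 2 + l = a * (a + 1)) :
    (r ^ 3) ^ (l ^ 2 + l) = r ^ (2 * a * (a + 1)) * r ^ (l ^ 2 + l) := by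
  rw [h, ← zpow_natCast r (2 * a * (a + 1)), ← zpow_add₀ hr0, ← zpow_natCast, ← zpow_mul]
  congr 1
  push_cast
  ring

/-- Expand each summand by `one_div_qPoch_mul_qPoch` with s = n + 1, t = n and exchange the sums.
The inner sum over n closes up by `sum_bailey_coeff`, and its factor r^{2(l²+l)} raises the Gaussian
from r to r³. -/
lemma sum_universal_mock (hr0 : r ≠ 0) (hr : ‖r‖ < 1) {x : ℂ} (hx0 : x ≠ 0)
    (hx : ∀ l : ℤ, 1 - x * (r ^ 2) ^ l ≠ 0) (N : ℕ) :
    ∑ n ∈ Finset.range (N + 1), 1 / qPoch (r ^ 2) (r ^ 2) (N - n) * (r ^ (2 * n * (n + 1)) /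
        (qPoch x (r ^ 2) (n + 1) * qPoch (r ^ 2 / x) (r ^ 2) (n + 1)))
      = ∑ l ∈ Finset.Icc (-((N + 1 : ℕ) : ℤ)) N,
          (1 / qPoch (r ^ 2) (r ^ 2) (((N + 1 : ℕ) : ℤ) + l).toNat) *
          (1 / qPoch (r ^ 2) (r ^ 2) (N - l).toNat) *
          ((-1) ^ l * (r ^ 3) ^ (l ^ 2 + l) / (1 - x * (r ^ 2) ^ l)) := by
  have h1 : ∀ n ∈ Finset.range (N + 1), 1 / qPoch (r ^ 2) (r ^ 2) (N - n) *
      (r ^ (2 * n * (n + 1)) / (qPoch x (r ^ 2) (n + 1) * qPoch (r ^ 2 / x) (r ^ 2) (n + 1)))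
      = ∑ l ∈ Finset.Icc (-((N + 1 : ℕ) : ℤ)) N,
        (if -((n + 1 : ℕ) : ℤ) ≤ l ∧ l ≤ n then 1 / qPoch (r ^ 2) (r ^ 2) (N - n) *
        r ^ (2 * n * (n + 1)) * (1 / qPoch (r ^ 2) (r ^ 2) (((n + 1 : ℕ) : ℤ) + l).toNat) *
        (1 / qPoch (r ^ 2) (r ^ 2) (n - l).toNat) else 0) *
        ((-1) ^ l * r ^ (l ^ 2 + l) / (1 - x * (r ^ 2) ^ l)) := by
    intro n hn
    have hn' : n ≤ N := by simpa [Nat.lt_succ_iff] using hn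
    rw [div_eq_mul_one_div (r ^ (2 * n * (n + 1))), one_div_qPoch_mul_qPoch hr0 hr hx0 hx (n + 1) n,
      ← mul_assoc, Finset.mul_sum]
    refine Finset.sum_subset_zero_on_sdiff ?_ ?_ ?_
    · intro l hl
      rw [Finset.mem_Icc] at hl ⊢
      omega
    · intro l hl
      rw [Finset.mem_sdiff, Finset.mem_Icc, Finset.mem_Icc] at hl
      rw [if_neg hl.2, zero_mul]
    · intro l hl
      rw [Finset.mem_Icc] at hl
      rw [if_pos hl]
      ring
  rw [Finset.sum_congr rfl h1, Finset.sum_comm]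
  refine Finset.sum_congr rfl fun l hl => ?_
  rw [← Finset.sum_mul]
  rw [Finset.mem_Icc] at hl
  rcases le_or_gt 0 l with h0 | h0
  · obtain ⟨a, rfl⟩ := Int.eq_ofNat_of_zero_le h0
    have ha : a ≤ N := by omega
    have h2 := sum_bailey_coeff hr ha
    rw [zpow_cube_gaussian hr0 _ a (by ring), show ((N + 1 : ℕ) : ℤ) + a = (N + 1 + a : ℕ) by simp,
      Int.toNat_natCast, show (N : ℤ) - a = (N - a : ℕ) by omega, Int.toNat_natCast]
    have h3 : ∀ n : ℕ, (if -((n + 1 : ℕ) : ℤ) ≤ a ∧ (a : ℤ) ≤ n then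
        1 / qPoch (r ^ 2) (r ^ 2) (N - n) *
        r ^ (2 * n * (n + 1)) * (1 / qPoch (r ^ 2) (r ^ 2) (((n + 1 : ℕ) : ℤ) + a).toNat) *
        (1 / qPoch (r ^ 2) (r ^ 2) ((n : ℤ) - a).toNat) else 0)
        = (if a ≤ n then 1 / qPoch (r ^ 2) (r ^ 2) (N - n) *
        r ^ (2 * n * (n + 1)) * (1 / qPoch (r ^ 2) (r ^ 2) (n + 1 + a)) *
        (1 / qPoch (r ^ 2) (r ^ 2) (n - a)) else 0) := by
      intro n
      by_cases h : a ≤ n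
      · rw [if_pos h, if_pos (by omega), show (((n + 1 : ℕ) : ℤ) + a).toNat = n + 1 + a by omega,
          show ((n : ℤ) - a).toNat = n - a by omega]
      · rw [if_neg h, if_neg (by omega)]
    simp only [h3, h2]
    ring
  -- The reflection l = -(a+1) keeps l² + l = a(a+1) and swaps the two Pochhammer indices.
  · obtain ⟨a, ha⟩ : ∃ a : ℕ, l = -((a + 1 : ℕ) : ℤ) := ⟨(-l - 1).toNat, by omega⟩
    have haN : a ≤ N := by omega
    have h2 := sum_bailey_coeff hr haN
    rw [zpow_cube_gaussian hr0 _ a (by rw [ha]; push_cast; ring),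
      show (((N + 1 : ℕ) : ℤ) + l).toNat = N - a by omega,
      show ((N : ℤ) - l).toNat = N + 1 + a by omega]
    have h3 : ∀ n : ℕ, (if -((n + 1 : ℕ) : ℤ) ≤ l ∧ l ≤ n then
        1 / qPoch (r ^ 2) (r ^ 2) (N - n) *
        r ^ (2 * n * (n + 1)) * (1 / qPoch (r ^ 2) (r ^ 2) (((n + 1 : ℕ) : ℤ) + l).toNat) *
        (1 / qPoch (r ^ 2) (r ^ 2) ((n : ℤ) - l).toNat) else 0)
        = (if a ≤ n then 1 / qPoch (r ^ 2) (r ^ 2) (N - n) *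
        r ^ (2 * n * (n + 1)) * (1 / qPoch (r ^ 2) (r ^ 2) (n + 1 + a)) *
        (1 / qPoch (r ^ 2) (r ^ 2) (n - a)) else 0) := by
      intro n
      by_cases h : a ≤ n
      · rw [if_pos h, if_pos (by omega), show (((n + 1 : ℕ) : ℤ) + l).toNat = n - a by omega,
          show ((n : ℤ) - l).toNat = n + 1 + a by omega]
        ring
      · rw [if_neg h, if_neg (by omega)]
    simp only [h3, h2]
    ring

lemma summable_universal_mock (hr0 : r ≠ 0) (hr : ‖r‖ < 1) {x : ℂ} (hx0 : x ≠ 0)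
    (hx : ∀ l : ℤ, 1 - x * (r ^ 2) ^ l ≠ 0) :
    Summable fun n : ℕ => r ^ (2 * n * (n + 1)) /
        (qPoch x (r ^ 2) (n + 1) * qPoch (r ^ 2 / x) (r ^ 2) (n + 1)) := by
  have hP := norm_sq_lt_one hr
  have hlim : Tendsto (fun n => 1 / (qPoch x (r ^ 2) (n + 1) * qPoch (r ^ 2 / x) (r ^ 2) (n + 1)))
      atTop (𝓝 (1 / (qPochInf x (r ^ 2) * qPochInf (r ^ 2 / x) (r ^ 2)))) := by
    refine tendsto_const_nhds.div (((tendsto_add_atTop_iff_nat 1).mpr (tendsto_qPoch hP x)).mul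
      ((tendsto_add_atTop_iff_nat 1).mpr (tendsto_qPoch hP _))) (mul_ne_zero ?_ ?_)
    · exact qPochInf_ne_zero hP (one_sub_pow_mul_ne_zero' hx)
    · exact qPochInf_ne_zero hP (one_sub_pow_mul_div_ne_zero hr0 hx0 hx)
  obtain ⟨C, hC0, hC⟩ := exists_norm_le_of_tendsto hlim
  have hgeom : Summable fun n : ℕ => C * ‖r‖ ^ n :=
    (summable_geometric_of_lt_one (norm_nonneg _) hr).mul_left C
  refine Summable.of_norm_bounded hgeom fun n => ?_
  rw [div_eq_mul_one_div, norm_mul, norm_pow, mul_comm]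
  refine mul_le_mul (hC n) ?_ (by positivity) hC0
  exact pow_le_pow_of_le_one (norm_nonneg _) hr.le (by nlinarith)

theorem tsum_universal_mock (hr0 : r ≠ 0) (hr : ‖r‖ < 1) {x : ℂ} (hx0 : x ≠ 0)
    (hx : ∀ l : ℤ, 1 - x * (r ^ 2) ^ l ≠ 0) :
    qPochInf (r ^ 2) (r ^ 2) * ∑' n : ℕ, r ^ (2 * n * (n + 1)) /
        (qPoch x (r ^ 2) (n + 1) * qPoch (r ^ 2 / x) (r ^ 2) (n + 1))
      = ∑' l : ℤ, (-1) ^ l * (r ^ 3) ^ (l ^ 2 + l) / (1 - x * (r ^ 2) ^ l) := by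
  have hP := norm_sq_lt_one hr
  have hPI := qPochInf_self_ne_zero hP
  have hw : Tendsto (fun n => 1 / qPoch (r ^ 2) (r ^ 2) n) atTop
      (𝓝 (1 / qPochInf (r ^ 2) (r ^ 2))) :=
    tendsto_const_nhds.div (tendsto_qPoch hP _) hPI
  have hr3 : ‖r ^ 3‖ < 1 := by
    rw [norm_pow]; exact pow_lt_one₀ (norm_nonneg _) hr (by norm_num)
  have hg : Summable fun l : ℤ => (-1) ^ l * (r ^ 3) ^ (l ^ 2 + l) / (1 - x * (r ^ 2) ^ l) :=
    summable_appell (pow_ne_zero 3 hr0) hr3 (pow_ne_zero 2 hr0) hP (by norm_num) hx0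
  have h1 := tendsto_sum_Icc_weighted (s := fun n => n + 1) (t := fun n => n) hw hw hg
    (tendsto_add_atTop_nat 1) tendsto_id
  simp only [← sum_universal_mock hr0 hr hx0 hx] at h1
  have h2 := tendsto_sum_range_weighted hw (summable_universal_mock hr0 hr hx0 hx)
  have h3 := tendsto_nhds_unique h1 h2
  field_simp at h3
  rw [mul_comm]
  linear_combination -h3

end Bailey

/-! ### Sextic Appell sums and their relation to ω₃. -/

section LevelOne

variable {Q : ℂ}

lemma one_sub_mul_zpow_ne_zero (h1 : ‖Q‖ < 1) {x : ℂ} (hx : ‖x‖ = 1) {m : ℤ}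
    (hm : m ≠ 0) : 1 - x * Q ^ m ≠ 0 := by
  intro h
  have h2 := congrArg norm (sub_eq_zero.mp h)
  rw [norm_one, norm_mul, hx, one_mul, norm_zpow] at h2
  exact hm ((zpow_eq_one_iff_right₀ (norm_nonneg _) h1.ne).mp h2.symm)

lemma one_sub_zpow_ne_zero (h1 : ‖Q‖ < 1) {m : ℤ} (hm : m ≠ 0) : 1 - Q ^ m ≠ 0 := by
  simpa using one_sub_mul_zpow_ne_zero h1 norm_one hm

/-- The general term `(-1)^l Q^{3l² + al + b} / (1 - Q^{6l + c})`. -/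
noncomputable def sexticTerm (a b c : ℤ) (Q : ℂ) (l : ℤ) : ℂ :=
  (-1) ^ l * Q ^ (3 * l ^ 2 + a * l + b) / (1 - Q ^ (6 * l + c))

/-- The bilateral sum of `sexticTerm a b c Q`. -/
noncomputable def sexticSum (a b c : ℤ) (Q : ℂ) : ℂ := ∑' l, sexticTerm a b c Q l

lemma sexticTerm_eq (h0 : Q ≠ 0) (u c l : ℤ) :
    sexticTerm (u + 3) 0 c Q l
      = (-Q ^ u) ^ l * (Q ^ 3) ^ (l ^ 2 + l) / (1 - Q ^ c * (Q ^ 6) ^ l) := by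
  have e1 : (Q ^ 6) ^ l = Q ^ (6 * l) := by rw [zpow_mul]; norm_cast
  have e2 : (Q ^ 3) ^ (l ^ 2 + l) = Q ^ (3 * (l ^ 2 + l)) := by rw [zpow_mul]; norm_cast
  rw [sexticTerm, neg_eq_neg_one_mul (Q ^ u), mul_zpow, e1, e2, ← zpow_mul, ← zpow_add₀ h0,
    mul_assoc, ← zpow_add₀ h0]
  rw [add_comm c]
  congr 3
  ring

lemma sexticTerm_add (h0 : Q ≠ 0) (a b c k l : ℤ) :
    sexticTerm a (b + k) c Q l = Q ^ k * sexticTerm a b c Q l := by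
  rw [sexticTerm, sexticTerm, ← add_assoc, zpow_add₀ h0 _ k]
  ring

lemma summable_sexticTerm (h0 : Q ≠ 0) (h1 : ‖Q‖ < 1) (a b c : ℤ) :
    Summable (sexticTerm a b c Q) := by
  have hpow : ∀ n : ℕ, n ≠ 0 → ‖Q ^ n‖ < 1 := fun n hn => by
    rw [norm_pow]; exact pow_lt_one₀ (norm_nonneg _) h1 hn
  have := (summable_appell (R := Q ^ 3) (y := Q ^ 6) (a := -Q ^ (a - 3)) (x := Q ^ c)
    (pow_ne_zero 3 h0) (hpow 3 (by norm_num)) (pow_ne_zero 6 h0) (hpow 6 (by norm_num))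
    (neg_ne_zero.mpr (zpow_ne_zero _ h0)) (zpow_ne_zero _ h0)).mul_left (Q ^ b)
  refine this.congr fun l => ?_
  rw [← sexticTerm_eq h0, ← sexticTerm_add h0]
  simp

lemma sexticSum_add (h0 : Q ≠ 0) (a b c k : ℤ) :
    sexticSum a (b + k) c Q = Q ^ k * sexticSum a b c Q := by
  rw [sexticSum, sexticSum, ← tsum_mul_left]
  exact tsum_congr fun l => sexticTerm_add h0 a b c k l

/-- This holds even where the denominators vanish, as both sides are then zero; hence the reindexing
lemmas below put no condition on c. -/
lemma zpow_div_one_sub_zpow_neg (h0 : Q ≠ 0) (u v : ℤ) :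
    Q ^ u / (1 - Q ^ (-v)) = -(Q ^ (u + v) / (1 - Q ^ v)) := by
  have hv := zpow_ne_zero v h0
  have hd : 1 - Q ^ (-v) = -(1 - Q ^ v) * (Q ^ v)⁻¹ := by
    rw [zpow_neg]
    field_simp
    ring
  rw [hd, zpow_add₀ h0, ← div_div, div_inv_eq_mul, div_neg]
  ring

lemma sexticSum_neg (h0 : Q ≠ 0) (a b c : ℤ) :
    sexticSum a b c Q = -sexticSum (6 - a) (b - c) (-c) Q := by
  rw [sexticSum, sexticSum, ← tsum_neg, ← (Equiv.neg ℤ).tsum_eq]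
  refine tsum_congr fun l => ?_
  rw [sexticTerm, sexticTerm, Equiv.neg_apply,
    show 6 * -l + c = -(6 * l + -c) by ring, mul_div_assoc, zpow_div_one_sub_zpow_neg h0,
    show 3 * (-l) ^ 2 + a * -l + b + (6 * l + -c) = 3 * l ^ 2 + (6 - a) * l + (b - c) by ring,
    zpow_neg, ← inv_zpow, inv_neg_one]
  ring

lemma sexticSum_reflect (h0 : Q ≠ 0) (a b c : ℤ) :
    sexticSum a b c Q = sexticSum (12 - a) (9 - a + b - c) (6 - c) Q := by
  rw [sexticSum, sexticSum, ← (Equiv.subLeft (-1 : ℤ)).tsum_eq]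
  refine tsum_congr fun l => ?_
  rw [sexticTerm, sexticTerm, Equiv.subLeft_apply,
    show 6 * (-1 - l) + c = -(6 * l + (6 - c)) by ring, mul_div_assoc,
    zpow_div_one_sub_zpow_neg h0,
    show 3 * (-1 - l) ^ 2 + a * (-1 - l) + b + (6 * l + (6 - c))
      = 3 * l ^ 2 + (12 - a) * l + (9 - a + b - c) by ring,
    zpow_sub₀ (by norm_num), zpow_neg_one, inv_neg_one, div_eq_mul_inv (-1 : ℂ), ← inv_zpow,
    inv_neg_one]
  ring

lemma sexticSum_three (h0 : Q ≠ 0) (h1 : ‖Q‖ < 1) :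
    sexticSum 3 0 3 Q = qPochInf (Q ^ 6) (Q ^ 6) ^ 2 / qPochInf (Q ^ 3) (Q ^ 6) ^ 2 := by
  have h3 : ‖Q ^ 3‖ < 1 := by
    rw [norm_pow]; exact pow_lt_one₀ (norm_nonneg _) h1 (by norm_num)
  have h := tsum_appell_one (r := Q ^ 3) (x := Q ^ 3) (pow_ne_zero 3 h0) h3 (pow_ne_zero 3 h0)
    (fun l => by
      rw [← pow_mul, ← zpow_natCast, ← zpow_natCast, ← zpow_mul, ← zpow_add₀ h0]
      exact one_sub_zpow_ne_zero h1 (by push_cast; omega))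
  rw [← pow_mul, show Q ^ (3 * 2) / Q ^ 3 = Q ^ 3 by field_simp] at h
  rw [sq (qPochInf (Q ^ 3) (Q ^ 6)), ← h, sexticSum]
  refine tsum_congr fun l => ?_
  have := sexticTerm_eq h0 0 3 l
  norm_num at this
  rw [this]

/-- The limit of `qPoch_quotient_eq_sum` with a choice of parameters for which the theta quotient
collapses to a multiple of the product in `sexticSum_three`. -/
lemma sexticSum_change (h0 : Q ≠ 0) (h1 : ‖Q‖ < 1) :
    sexticSum 5 0 1 Q = sexticSum 3 0 3 Q + sexticSum 5 1 3 Q := by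
  have hpow : ∀ n : ℕ, n ≠ 0 → ‖Q ^ n‖ < 1 := fun n hn => by
    rw [norm_pow]; exact pow_lt_one₀ (norm_nonneg _) h1 hn
  have hr0 := pow_ne_zero 3 h0
  have hr := hpow 3 (by norm_num)
  have hP := hpow 6 (by norm_num)
  have h36 : (Q ^ 3) ^ 2 = Q ^ 6 := by ring
  have hcond : ∀ (x : ℂ) (m : ℤ), x = Q ^ m → m % 6 ≠ 0 → ∀ l : ℤ, 1 - x * ((Q ^ 3) ^ 2) ^ l ≠ 0 := by
    rintro x m rfl hm l
    rw [h36, ← zpow_natCast, ← zpow_mul, ← zpow_add₀ h0]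
    exact one_sub_zpow_ne_zero h1 (by push_cast; omega)
  -- Take r = Q³, β = Q² and z = Q⁻¹. Then zβ = Q and zβ⁻¹ = Q⁻³ give the classes c = 1 and c = -3,
  -- and the latter becomes c = 3 under l ↦ -l.
  have hβ0 : Q ^ 2 ≠ 0 := pow_ne_zero 2 h0
  have hβ := hcond ((Q ^ 2) ^ 2) 4 (by rw [← pow_mul]; norm_cast) (by norm_num)
  have hβ' := hcond ((Q ^ 2)⁻¹ ^ 2) (-4) (by rw [inv_pow, ← pow_mul, zpow_neg]; norm_cast)
    (by norm_num)
  have hz := hcond (Q⁻¹ * Q ^ 2) 1 (by rw [zpow_one]; field_simp) (by norm_num)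
  have hz' := hcond (Q⁻¹ * (Q ^ 2)⁻¹) (-3)
    (by rw [zpow_neg, ← mul_inv, ← pow_succ']; norm_cast) (by norm_num)
  have key := fun n => qPoch_quotient_eq_sum hr0 hr hβ0 (inv_ne_zero h0) hβ hz hz' n
  have hs1 : Summable fun l : ℤ =>
      (-(Q ^ 2)⁻¹) ^ l * (Q ^ 3) ^ (l ^ 2 + l) / (1 - Q⁻¹ * (Q ^ 2)⁻¹ * ((Q ^ 3) ^ 2) ^ l) :=
    summable_appell hr0 hr (pow_ne_zero 2 hr0) (norm_sq_lt_one hr)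
      (neg_ne_zero.mpr (inv_ne_zero hβ0)) (mul_ne_zero (inv_ne_zero h0) (inv_ne_zero hβ0))
  have hs2 : Summable fun l : ℤ =>
      (-Q ^ 2) ^ l * (Q ^ 3) ^ (l ^ 2 + l) / (1 - Q⁻¹ * Q ^ 2 * ((Q ^ 3) ^ 2) ^ l) :=
    summable_appell hr0 hr (pow_ne_zero 2 hr0) (norm_sq_lt_one hr)
      (neg_ne_zero.mpr hβ0) (mul_ne_zero (inv_ne_zero h0) hβ0)
  have t1 := (tendsto_sum_Icc_weighted (s := fun n => n) (t := fun n => n)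
    (tendsto_poleWeight hr0 hr hβ0 hβ) (tendsto_poleWeight' hr hβ) hs1 tendsto_id tendsto_id).add
    (tendsto_sum_Icc_weighted (s := fun n => n) (t := fun n => n)
    (tendsto_poleWeight hr0 hr (inv_ne_zero hβ0) hβ') (tendsto_poleWeight' hr hβ') hs2
      tendsto_id tendsto_id)
  simp only [← key] at t1
  have e1 : ∑' l : ℤ, (-(Q ^ 2)⁻¹) ^ l * (Q ^ 3) ^ (l ^ 2 + l) /
      (1 - Q⁻¹ * (Q ^ 2)⁻¹ * ((Q ^ 3) ^ 2) ^ l) = -(Q ^ 2 * sexticSum 5 1 3 Q) := by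
    have := sexticSum_neg h0 1 0 (-3)
    norm_num at this
    rw [show (3 : ℤ) = 1 + 2 by norm_num, sexticSum_add h0, show (1 : ℤ) + 2 = 3 by norm_num] at this
    rw [show Q ^ 2 = Q ^ (2 : ℤ) by norm_cast, ← this, sexticSum]
    refine tsum_congr fun l => ?_
    have := sexticTerm_eq h0 (-2) (-3) l
    norm_num at this
    rw [this, h36, ← zpow_neg, ← zpow_neg_one, ← zpow_add₀ h0]
    norm_num
  have e2 : ∑' l : ℤ, (-Q ^ 2) ^ l * (Q ^ 3) ^ (l ^ 2 + l) /
      (1 - Q⁻¹ * Q ^ 2 * ((Q ^ 3) ^ 2) ^ l) = sexticSum 5 0 1 Q := by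
    rw [sexticSum]
    refine tsum_congr fun l => ?_
    have := sexticTerm_eq h0 2 1 l
    norm_num at this
    rw [this, h36, show Q⁻¹ * Q ^ 2 = Q by field_simp]
  rw [e1, e2] at t1
  have hlim := fun x => tendsto_qPoch (norm_sq_lt_one hr) x
  have hlim1 := fun x => (tendsto_add_atTop_iff_nat 1).mpr (hlim x)
  have hinf := fun (x : ℂ) (m : ℤ) (h : x = Q ^ m) (hm : m % 6 ≠ 0) =>
    qPochInf_ne_zero (norm_sq_lt_one hr) (one_sub_pow_mul_ne_zero' (hcond x m h hm))
  have x1 : (Q ^ 3) ^ 2 / (Q⁻¹ * (Q ^ 2)⁻¹) = Q ^ 9 := by field_simp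
  have x2 : (Q ^ 3) ^ 2 / (Q⁻¹ * Q ^ 2) = Q ^ 5 := by field_simp
  have x3 : (Q ^ 3) ^ 2 / Q⁻¹ = Q ^ 7 := by field_simp
  have t2 := ((hlim1 Q⁻¹).mul (hlim ((Q ^ 3) ^ 2 / Q⁻¹))).div
    (((hlim1 (Q⁻¹ * (Q ^ 2)⁻¹)).mul (hlim ((Q ^ 3) ^ 2 / (Q⁻¹ * (Q ^ 2)⁻¹)))).mul
      ((hlim1 (Q⁻¹ * Q ^ 2)).mul (hlim ((Q ^ 3) ^ 2 / (Q⁻¹ * Q ^ 2)))))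
    (mul_ne_zero (mul_ne_zero (hinf _ (-3)
      (by rw [zpow_neg, ← mul_inv, ← pow_succ']; norm_cast) (by norm_num))
      (hinf _ 9 (by rw [x1]; norm_cast) (by norm_num)))
      (mul_ne_zero (hinf _ 1 (by rw [zpow_one]; field_simp) (by norm_num))
      (hinf _ 5 (by rw [x2]; norm_cast) (by norm_num))))
  have h := tendsto_nhds_unique t1 t2
  have n2 := hinf (Q ^ 2) 2 (by norm_cast) (by norm_num)
  have n3 := hinf (Q ^ 3) 3 (by norm_cast) (by norm_num)
  have n4 := hinf (Q ^ 4) 4 (by norm_cast) (by norm_num)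
  have n5 := hinf (Q ^ 5) 5 (by norm_cast) (by norm_num)
  have n7 := hinf (Q ^ 7) 7 (by norm_cast) (by norm_num)
  have n8 := hinf (Q ^ 8) 8 (by norm_cast) (by norm_num)
  have n9 := hinf (Q ^ 9) 9 (by norm_cast) (by norm_num)
  have n10 := hinf (Q ^ 10) 10 (by norm_cast) (by norm_num)
  have nP := qPochInf_self_ne_zero hP
  rw [x1, x2, x3] at h
  rw [show Q⁻¹ * Q ^ 2 = Q by field_simp, show Q⁻¹ * (Q ^ 2)⁻¹ = (Q ^ 3)⁻¹ by field_simp,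
    show (Q ^ 3) ^ 2 / (Q ^ 2)⁻¹ = Q ^ 8 by field_simp,
    show (Q ^ 3) ^ 2 / (Q ^ 2)⁻¹ ^ 2 = Q ^ 10 by field_simp,
    show (Q ^ 3) ^ 2 / Q ^ 2 = Q ^ 4 by field_simp,
    show (Q ^ 3) ^ 2 / (Q ^ 2) ^ 2 = Q ^ 2 by field_simp,
    show (Q ^ 2)⁻¹ ^ 2 = (Q ^ 4)⁻¹ by field_simp,
    show (Q ^ 2) ^ 2 = Q ^ 4 by ring, h36] at h
  rw [h36] at n2 n3 n4 n5 n7 n8 n9 n10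
  have y1 : qPochInf Q⁻¹ (Q ^ 6) = (1 - Q⁻¹) * qPochInf (Q ^ 5) (Q ^ 6) := by
    rw [qPochInf_eq_mul hP, show Q ^ 6 * Q⁻¹ = Q ^ 5 by field_simp]
  have y2 : qPochInf Q (Q ^ 6) = (1 - Q) * qPochInf (Q ^ 7) (Q ^ 6) := by
    rw [qPochInf_eq_mul hP, show Q ^ 6 * Q = Q ^ 7 by ring]
  have y3 : qPochInf (Q ^ 3)⁻¹ (Q ^ 6) = (1 - (Q ^ 3)⁻¹) * qPochInf (Q ^ 3) (Q ^ 6) := by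
    rw [qPochInf_eq_mul hP, show Q ^ 6 * (Q ^ 3)⁻¹ = Q ^ 3 by field_simp]
  have y4 : qPochInf (Q ^ 3) (Q ^ 6) = (1 - Q ^ 3) * qPochInf (Q ^ 9) (Q ^ 6) := by
    rw [qPochInf_eq_mul hP, show Q ^ 6 * Q ^ 3 = Q ^ 9 by ring]
  have y5 : qPochInf (Q ^ 2)⁻¹ (Q ^ 6) = (1 - (Q ^ 2)⁻¹) * qPochInf (Q ^ 4) (Q ^ 6) := by
    rw [qPochInf_eq_mul hP, show Q ^ 6 * (Q ^ 2)⁻¹ = Q ^ 4 by field_simp]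
  have y6 : qPochInf (Q ^ 4)⁻¹ (Q ^ 6) = (1 - (Q ^ 4)⁻¹) * qPochInf (Q ^ 2) (Q ^ 6) := by
    rw [qPochInf_eq_mul hP, show Q ^ 6 * (Q ^ 4)⁻¹ = Q ^ 2 by field_simp]
  have y7 : qPochInf (Q ^ 2) (Q ^ 6) = (1 - Q ^ 2) * qPochInf (Q ^ 8) (Q ^ 6) := by
    rw [qPochInf_eq_mul hP, show Q ^ 6 * Q ^ 2 = Q ^ 8 by ring]
  have y8 : qPochInf (Q ^ 4) (Q ^ 6) = (1 - Q ^ 4) * qPochInf (Q ^ 10) (Q ^ 6) := by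
    rw [qPochInf_eq_mul hP, show Q ^ 6 * Q ^ 4 = Q ^ 10 by ring]
  have d : ∀ n : ℕ, n ≠ 0 → 1 - Q ^ n ≠ 0 := fun n hn => by
    have := one_sub_zpow_ne_zero h1 (m := n) (by exact_mod_cast hn)
    rwa [zpow_natCast] at this
  have d1 := d 1 one_ne_zero
  have d2 := d 2 two_ne_zero
  have d3 := d 3 three_ne_zero
  have d4 := d 4 four_ne_zero
  rw [pow_one] at d1
  have w1 : 1 - Q⁻¹ = -(1 - Q) / Q := by field_simp; ring
  have w2 : 1 - (Q ^ 2)⁻¹ = -(1 - Q ^ 2) / Q ^ 2 := by field_simp; ring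
  have w3 : 1 - (Q ^ 3)⁻¹ = -(1 - Q ^ 3) / Q ^ 3 := by field_simp; ring
  have w4 : 1 - (Q ^ 4)⁻¹ = -(1 - Q ^ 4) / Q ^ 4 := by field_simp; ring
  have hlhs : qPochInf (Q ^ 4) (Q ^ 6) / (qPochInf (Q ^ 2) (Q ^ 6) * qPochInf (Q ^ 6) (Q ^ 6)) *
      (qPochInf (Q ^ 2) (Q ^ 6) / (qPochInf (Q ^ 4) (Q ^ 6) * qPochInf (Q ^ 6) (Q ^ 6)))
      = 1 / qPochInf (Q ^ 6) (Q ^ 6) ^ 2 := by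
    field_simp
  have hlhs2 : qPochInf (Q ^ 8) (Q ^ 6) / (qPochInf (Q ^ 10) (Q ^ 6) * qPochInf (Q ^ 6) (Q ^ 6)) *
      (qPochInf (Q ^ 2)⁻¹ (Q ^ 6) / (qPochInf (Q ^ 4)⁻¹ (Q ^ 6) * qPochInf (Q ^ 6) (Q ^ 6)))
      = Q ^ 2 / qPochInf (Q ^ 6) (Q ^ 6) ^ 2 := by
    rw [y5, y6, y7, y8, w2, w4]
    field_simp
  have hrhs : qPochInf Q⁻¹ (Q ^ 6) * qPochInf (Q ^ 7) (Q ^ 6) /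
      (qPochInf (Q ^ 3)⁻¹ (Q ^ 6) * qPochInf (Q ^ 9) (Q ^ 6) *
        (qPochInf Q (Q ^ 6) * qPochInf (Q ^ 5) (Q ^ 6)))
      = Q ^ 2 / qPochInf (Q ^ 3) (Q ^ 6) ^ 2 := by
    rw [y1, y2, y3, y4, w1, w3]
    field_simp
  rw [hlhs, hlhs2, hrhs] at h
  rw [sexticSum_three h0 h1]
  field_simp at h ⊢
  linear_combination h

lemma universal_mock_eq_sexticSum (h0 : Q ≠ 0) (h1 : ‖Q‖ < 1) :
    qPochInf (Q ^ 2) (Q ^ 2) * omega3 Q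
      = sexticSum 5 0 1 Q - sexticSum 3 0 3 Q + sexticSum 7 3 5 Q := by
  have hx : ∀ l : ℤ, 1 - Q * (Q ^ 2) ^ l ≠ 0 := fun l => by
    rw [← zpow_natCast, ← zpow_mul, ← zpow_one_add₀ h0]
    exact one_sub_zpow_ne_zero h1 (by push_cast; omega)
  have h := tsum_universal_mock h0 h1 h0 hx
  rw [show Q ^ 2 / Q = Q by field_simp] at h
  have hω : omega3 Q = ∑' n : ℕ, Q ^ (2 * n * (n + 1)) /
      (qPoch Q (Q ^ 2) (n + 1) * qPoch Q (Q ^ 2) (n + 1)) := by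
    simp only [omega3, omega3Term, sq (qPoch _ _ _)]
  rw [hω, h]
  -- Use 1/(1 - y) = (1 + y + y²)/(1 - y³) with y = Q^{2l+1}.
  have e1 : ∑' l : ℤ, (-1) ^ l * (Q ^ 3) ^ (l ^ 2 + l) / (1 - Q * (Q ^ 2) ^ l)
      = sexticSum 3 0 3 Q + sexticSum 5 1 3 Q + sexticSum 7 2 3 Q := by
    rw [sexticSum, sexticSum, sexticSum, ← Summable.tsum_add (summable_sexticTerm h0 h1 _ _ _)
      (summable_sexticTerm h0 h1 _ _ _), ← Summable.tsum_add ((summable_sexticTerm h0 h1 _ _ _).add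
      (summable_sexticTerm h0 h1 _ _ _)) (summable_sexticTerm h0 h1 _ _ _)]
    refine tsum_congr fun l => ?_
    simp only [sexticTerm]
    have hy := one_sub_zpow_ne_zero h1 (m := 2 * l + 1) (by omega)
    have hy3 := one_sub_zpow_ne_zero h1 (m := 6 * l + 3) (by omega)
    have i1 : Q * (Q ^ 2) ^ l = Q ^ (2 * l + 1) := by
      rw [← zpow_natCast, ← zpow_mul, ← zpow_one_add₀ h0]; congr 1; push_cast; ring
    have i2 : Q ^ (6 * l + 3) = (Q ^ (2 * l + 1)) ^ 3 := by
      rw [← zpow_natCast, ← zpow_mul]; congr 1; push_cast; ring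
    have i3 : Q ^ (3 * l ^ 2 + 5 * l + 1) = (Q ^ 3) ^ (l ^ 2 + l) * Q ^ (2 * l + 1) := by
      rw [← zpow_natCast, ← zpow_mul, ← zpow_add₀ h0]; congr 1; push_cast; ring
    have i4 : Q ^ (3 * l ^ 2 + 7 * l + 2)
        = (Q ^ 3) ^ (l ^ 2 + l) * (Q ^ (2 * l + 1)) ^ 2 := by
      rw [← zpow_natCast, ← zpow_natCast, ← zpow_mul, ← zpow_mul, ← zpow_add₀ h0]
      congr 1; push_cast; ring
    have i5 : Q ^ (3 * l ^ 2 + 3 * l + 0) = (Q ^ 3) ^ (l ^ 2 + l) := by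
      rw [← zpow_natCast, ← zpow_mul]; congr 1; push_cast; ring
    rw [i2] at hy3
    rw [i1, i2, i3, i4, i5, ← add_div, ← add_div, div_eq_div_iff hy hy3]
    ring
  -- The reflection l ↦ -1-l identifies the sums in pairs, after which the claim is twice
  -- `sexticSum_change`.
  have r1 := sexticSum_reflect h0 5 1 3
  have r2 := sexticSum_reflect h0 5 0 1
  norm_num at r1 r2
  rw [e1, ← r1, ← r2, sexticSum_change h0 h1]
  ring

end LevelOne

/-! ### Arithmetic of ζ₃. -/

section CubeRoots

lemma exp_neg_pi_div_three :
    Complex.exp (-(Real.pi * Complex.I) / 3) = 1 / 2 - (Real.sqrt 3 : ℂ) / 2 * Complex.I := by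
  rw [show -(Real.pi * Complex.I) / 3 = ((-(Real.pi / 3) : ℝ) : ℂ) * Complex.I by push_cast; ring,
    Complex.exp_mul_I, ← Complex.ofReal_cos, ← Complex.ofReal_sin, Real.cos_neg, Real.sin_neg,
    Real.cos_pi_div_three, Real.sin_pi_div_three]
  push_cast
  ring

lemma exp_neg_pi_div_three_eq_neg_zeta3 :
    Complex.exp (-(Real.pi * Complex.I) / 3) = -zeta3 := by
  rw [zeta3, show 2 * Real.pi * Complex.I / 3 = Real.pi * Complex.I + -(Real.pi * Complex.I) / 3 by
    ring, Complex.exp_add, Complex.exp_pi_mul_I]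
  ring

lemma zeta3_eq : zeta3 = -1 / 2 + (Real.sqrt 3 : ℂ) / 2 * Complex.I := by
  rw [← neg_neg zeta3, ← exp_neg_pi_div_three_eq_neg_zeta3, exp_neg_pi_div_three]
  ring

lemma sqrt_three_sq : (Real.sqrt 3 : ℂ) ^ 2 = 3 := by
  norm_cast
  norm_num

lemma zeta3_sq_add : zeta3 ^ 2 + zeta3 + 1 = 0 := by
  rw [zeta3_eq]
  linear_combination (Complex.I ^ 2 / 4) * sqrt_three_sq + 3 / 4 * Complex.I_sq

lemma zeta3_cube : zeta3 ^ 3 = 1 := by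
  linear_combination (zeta3 - 1) * zeta3_sq_add

lemma zeta3_ne_zero : zeta3 ≠ 0 := Complex.exp_ne_zero _

lemma norm_zeta3 : ‖zeta3‖ = 1 :=
  (pow_eq_one_iff_of_nonneg (norm_nonneg _) three_ne_zero).mp (by rw [← norm_pow, zeta3_cube, norm_one])

lemma zeta3_sq_sub : zeta3 ^ 2 - zeta3 = -(Real.sqrt 3 * Complex.I) := by
  have h := zeta3_eq
  linear_combination zeta3_sq_add - 2 * h

end CubeRoots

/-! ### The Appell sums at the three cube roots of unity. -/

section Appell

variable {q : ℂ}

/-- The general term `(-1)^n x^{2n} q^{n²+n} / (1 - x q^{2n+1})`. -/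
noncomputable def appellTerm (x q : ℂ) (n : ℤ) : ℂ :=
  (-1) ^ n * x ^ (2 * n) * q ^ (n ^ 2 + n) / (1 - x * q ^ (2 * n + 1))

lemma appellTerm_eq (h0 : q ≠ 0) (x : ℂ) (n : ℤ) : appellTerm x q n
    = (-x ^ 2) ^ n * q ^ (n ^ 2 + n) / (1 - x * q * (q ^ 2) ^ n) := by
  have e1 : (q ^ 2) ^ n = q ^ (2 * n) := by rw [zpow_mul]; norm_cast
  have e2 : (x ^ 2) ^ n = x ^ (2 * n) := by rw [zpow_mul]; norm_cast
  rw [appellTerm, neg_eq_neg_one_mul (x ^ 2), mul_zpow, e1, e2, zpow_add_one₀ h0, mul_assoc x,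
    mul_comm q]

lemma summable_appellTerm (h0 : q ≠ 0) (h1 : ‖q‖ < 1) {x : ℂ} (hx : x ≠ 0) :
    Summable (appellTerm x q) := by
  refine (summable_appell (a := -x ^ 2) (x := x * q) h0 h1 (pow_ne_zero 2 h0) (norm_sq_lt_one h1)
    (neg_ne_zero.mpr (pow_ne_zero 2 hx)) (mul_ne_zero hx h0)).congr fun n => ?_
  rw [appellTerm_eq h0]

lemma tsum_int_eq_tsum_mod_three {f : ℤ → ℂ} (hf : Summable f) :
    ∑' n, f n = ∑' l : ℤ, (f (3 * l) + f (3 * l + 1) + f (3 * l + 2)) := by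
  have hs := (Int.divModEquiv 3).symm.summable_iff.mpr hf
  rw [← (Int.divModEquiv 3).symm.tsum_eq f]
  refine (Summable.tsum_prod hs).trans (tsum_congr fun l => ?_)
  rw [tsum_fintype, Fin.sum_univ_three]
  simp [Int.divModEquiv, mul_comm]

lemma one_sub_cube (y : ℂ) :
    1 - y ^ 3 = (1 - y) * (1 - zeta3 * y) * (1 - zeta3 ^ 2 * y) := by
  linear_combination (y - y ^ 2 * zeta3) * zeta3_sq_add + y ^ 3 * zeta3_cube

/-- A roots-of-unity filter: over the common denominator 1 - y³, each weighting keeps a single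
monomial of 1 + y + y². -/
lemma sum_cube_roots {y : ℂ} (h1 : 1 - y ≠ 0) (h2 : 1 - zeta3 * y ≠ 0)
    (h3 : 1 - zeta3 ^ 2 * y ≠ 0) :
    1 / (1 - y) + 1 / (1 - zeta3 * y) + 1 / (1 - zeta3 ^ 2 * y) = 3 / (1 - y ^ 3) ∧
    1 / (1 - y) + zeta3 / (1 - zeta3 * y) + zeta3 ^ 2 / (1 - zeta3 ^ 2 * y)
      = 3 * y ^ 2 / (1 - y ^ 3) ∧
    1 / (1 - y) + zeta3 ^ 2 / (1 - zeta3 * y) + zeta3 / (1 - zeta3 ^ 2 * y)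
      = 3 * y / (1 - y ^ 3) := by
  have hD : 1 - y ^ 3 ≠ 0 := by
    rw [one_sub_cube]
    exact mul_ne_zero (mul_ne_zero h1 h2) h3
  have hS := zeta3_sq_add
  have hz := zeta3_cube
  generalize zeta3 = z at *
  have f1 : 1 / (1 - y) = (1 + y + y ^ 2) / (1 - y ^ 3) := by
    rw [div_eq_div_iff h1 hD]; ring
  have f2 : ∀ a, a / (1 - z * y) = a * (1 + z * y + z ^ 2 * y ^ 2) / (1 - y ^ 3) := fun a => by
    rw [div_eq_div_iff h2 hD]
    linear_combination (a * y ^ 3) * hz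
  have f3 : ∀ a, a / (1 - z ^ 2 * y) = a * (1 + z ^ 2 * y + z ^ 4 * y ^ 2) / (1 - y ^ 3) :=
    fun a => by
      rw [div_eq_div_iff h3 hD]
      linear_combination (a * y ^ 3 * (z ^ 3 + 1)) * hz
  rw [f1, f2, f3, f2, f3, f2, f3]
  refine ⟨?_, ?_, ?_⟩ <;> rw [← add_div, ← add_div] <;> congr 1
  · linear_combination (y + y ^ 2 * (z ^ 2 - z + 1)) * hS
  · linear_combination (1 + y * (z ^ 2 - z + 1) + y ^ 2 * ((z - 1) + (z ^ 3 + 1) * (z - 1))) * hS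
  · linear_combination (1 + 2 * y * (z - 1) + y ^ 2 * (z ^ 3 - z + 1)) * hS

lemma one_add_zeta3_combination (h0 : q ≠ 0) (h1 : ‖q‖ < 1) :
    ∑' n, appellTerm 1 q n + zeta3 * ∑' n, appellTerm zeta3 q n
        + zeta3 ^ 2 * ∑' n, appellTerm (zeta3 ^ 2) q n
      = 3 * q ^ 2 * (sexticSum 5 0 1 (q ^ 3) - sexticSum 3 0 3 (q ^ 3) + sexticSum 7 3 5 (q ^ 3)) := by
  have hQ0 : q ^ 3 ≠ 0 := pow_ne_zero 3 h0
  have hQ1 : ‖q ^ 3‖ < 1 := by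
    rw [norm_pow]; exact pow_lt_one₀ (norm_nonneg _) h1 (by norm_num)
  have s1 := summable_appellTerm h0 h1 one_ne_zero
  have s2 := (summable_appellTerm h0 h1 zeta3_ne_zero).mul_left zeta3
  have s3 := (summable_appellTerm h0 h1 (pow_ne_zero 2 zeta3_ne_zero)).mul_left (zeta3 ^ 2)
  have t1 := summable_sexticTerm hQ0 hQ1 5 0 1
  have t2 := summable_sexticTerm hQ0 hQ1 3 0 3
  have t3 := summable_sexticTerm hQ0 hQ1 7 3 5
  rw [← tsum_mul_left, ← tsum_mul_left, ← Summable.tsum_add s1 s2,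
    ← Summable.tsum_add (s1.add s2) s3, tsum_int_eq_tsum_mod_three ((s1.add s2).add s3), sexticSum,
    sexticSum, sexticSum, ← Summable.tsum_sub t1 t2, ← Summable.tsum_add (t1.sub t2) t3,
    ← tsum_mul_left]
  refine tsum_congr fun l => ?_
  have hz6 : zeta3 ^ (6 * l) = 1 := by
    rw [zpow_mul, show zeta3 ^ (6 : ℤ) = (zeta3 ^ 3) ^ 2 by rw [← pow_mul]; norm_cast, zeta3_cube]
    simp
  have hz12 : (zeta3 ^ 2) ^ (6 * l) = 1 := by
    rw [zpow_mul, show (zeta3 ^ 2) ^ (6 : ℤ) = (zeta3 ^ 3) ^ 4 by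
      rw [← pow_mul]; norm_cast; rw [← pow_mul], zeta3_cube]
    simp
  have hz0 := zeta3_ne_zero
  have hz20 := pow_ne_zero 2 hz0
  have a1 : ∀ j : ℤ, zeta3 ^ (2 * (3 * l + j)) = zeta3 ^ (2 * j) := fun j => by
    rw [mul_add, zpow_add₀ hz0, show 2 * (3 * l) = 6 * l by ring, hz6, one_mul]
  have a2 : ∀ j : ℤ, (zeta3 ^ 2) ^ (2 * (3 * l + j)) = (zeta3 ^ 2) ^ (2 * j) := fun j => by
    rw [mul_add, zpow_add₀ hz20, show 2 * (3 * l) = 6 * l by ring, hz12, one_mul]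
  -- On the class j mod 3 the weight at ζ₃ is ζ₃^{1+2j}, that is ζ₃, 1, ζ₃² for j = 0, 1, 2, so the
  -- filter returns y², 1, y respectively.
  have hterm : ∀ j : ℤ, appellTerm 1 q (3 * l + j) + zeta3 * appellTerm zeta3 q (3 * l + j) +
      zeta3 ^ 2 * appellTerm (zeta3 ^ 2) q (3 * l + j)
      = (-1) ^ (3 * l + j) * q ^ ((3 * l + j) ^ 2 + (3 * l + j)) *
        (1 / (1 - q ^ (6 * l + 2 * j + 1)) + zeta3 * zeta3 ^ (2 * j) /
          (1 - zeta3 * q ^ (6 * l + 2 * j + 1)) + zeta3 ^ 2 * (zeta3 ^ 2) ^ (2 * j) /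
          (1 - zeta3 ^ 2 * q ^ (6 * l + 2 * j + 1))) := fun j => by
    simp only [appellTerm, a1, a2, one_zpow, one_mul, mul_one,
      show 2 * (3 * l + j) + 1 = 6 * l + 2 * j + 1 by ring]
    ring
  have hroots := fun (j : ℤ) => sum_cube_roots (y := q ^ (6 * l + 2 * j + 1))
    (one_sub_zpow_ne_zero h1 (by omega)) (one_sub_mul_zpow_ne_zero h1 norm_zeta3 (by omega))
    (one_sub_mul_zpow_ne_zero h1 (by rw [norm_pow, norm_zeta3, one_pow]) (by omega))
  have hpow : ∀ m : ℤ, (q ^ 3) ^ m = q ^ (3 * m) := fun m => by rw [zpow_mul]; norm_cast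
  have hneg : ∀ j : ℤ, (-1 : ℂ) ^ (3 * l + j) = (-1) ^ l * (-1) ^ j := fun j => by
    rw [zpow_add₀ (by norm_num), zpow_mul]; norm_num
  have hcube : ∀ m : ℤ, (q ^ m) ^ 3 = q ^ (3 * m) := fun m => by
    rw [← zpow_natCast, ← zpow_mul, mul_comm]; norm_cast
  have b0 : appellTerm 1 q (3 * l) + zeta3 * appellTerm zeta3 q (3 * l) +
      zeta3 ^ 2 * appellTerm (zeta3 ^ 2) q (3 * l) = 3 * q ^ 2 * sexticTerm 5 0 1 (q ^ 3) l := by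
    have h := hterm 0
    have hr := (hroots 0).2.1
    have hq2 : q ^ 2 * q ^ (3 * (3 * l ^ 2 + 5 * l + 0))
        = q ^ ((3 * l) ^ 2 + 3 * l) * (q ^ (6 * l + 2 * 0 + 1)) ^ 2 := by
      rw [← zpow_natCast, ← zpow_natCast, ← zpow_mul, ← zpow_add₀ h0, ← zpow_add₀ h0]
      congr 1; push_cast; ring
    rw [hcube, show 3 * (6 * l + 2 * 0 + 1) = 3 * (6 * l + 1) by ring] at hr
    have hn := hneg 0
    simp only [mul_zero, zpow_zero, mul_one, add_zero] at h hr hn hq2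
    rw [h, hr, sexticTerm, hpow, hpow, hn, add_zero]
    linear_combination (-3 * (-1) ^ l / (1 - q ^ (3 * (6 * l + 1)))) * hq2
  have b1 : appellTerm 1 q (3 * l + 1) + zeta3 * appellTerm zeta3 q (3 * l + 1) +
      zeta3 ^ 2 * appellTerm (zeta3 ^ 2) q (3 * l + 1)
      = -(3 * q ^ 2 * sexticTerm 3 0 3 (q ^ 3) l) := by
    have h := hterm 1
    have hr := (hroots 1).1
    have hq2 : q ^ 2 * q ^ (3 * (3 * l ^ 2 + 3 * l + 0)) = q ^ ((3 * l + 1) ^ 2 + (3 * l + 1)) := by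
      rw [← zpow_natCast, ← zpow_add₀ h0]
      congr 1; push_cast; ring
    rw [hcube, show 3 * (6 * l + 2 * 1 + 1) = 3 * (6 * l + 3) by ring] at hr
    have g1 : zeta3 * zeta3 ^ (2 * 1 : ℤ) = 1 := by
      rw [← zeta3_cube]; norm_cast; ring
    have g2 : zeta3 ^ 2 * (zeta3 ^ 2) ^ (2 * 1 : ℤ) = 1 := by
      have : zeta3 ^ 2 * (zeta3 ^ 2) ^ (2 * 1 : ℤ) = (zeta3 ^ 3) ^ 2 := by norm_cast; ring
      rw [this, zeta3_cube, one_pow]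
    rw [h, g1, g2, hr, sexticTerm, hpow, hpow, hneg, zpow_one]
    linear_combination (3 * (-1) ^ l / (1 - q ^ (3 * (6 * l + 3)))) * hq2
  have b2 : appellTerm 1 q (3 * l + 2) + zeta3 * appellTerm zeta3 q (3 * l + 2) +
      zeta3 ^ 2 * appellTerm (zeta3 ^ 2) q (3 * l + 2)
      = 3 * q ^ 2 * sexticTerm 7 3 5 (q ^ 3) l := by
    have h := hterm 2
    have hr := (hroots 2).2.2
    have hq2 : q ^ 2 * q ^ (3 * (3 * l ^ 2 + 7 * l + 3))
        = q ^ ((3 * l + 2) ^ 2 + (3 * l + 2)) * q ^ (6 * l + 2 * 2 + 1) := by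
      rw [← zpow_natCast, ← zpow_add₀ h0, ← zpow_add₀ h0]
      congr 1; push_cast; ring
    rw [hcube, show 3 * (6 * l + 2 * 2 + 1) = 3 * (6 * l + 5) by ring] at hr
    have g1 : zeta3 * zeta3 ^ (2 * 2 : ℤ) = zeta3 ^ 2 := by
      have : zeta3 * zeta3 ^ (2 * 2 : ℤ) = zeta3 ^ 3 * zeta3 ^ 2 := by norm_cast; ring
      rw [this, zeta3_cube, one_mul]
    have g2 : zeta3 ^ 2 * (zeta3 ^ 2) ^ (2 * 2 : ℤ) = zeta3 := by
      have : zeta3 ^ 2 * (zeta3 ^ 2) ^ (2 * 2 : ℤ) = (zeta3 ^ 3) ^ 3 * zeta3 := by norm_cast; ring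
      rw [this, zeta3_cube, one_pow, one_mul]
    have g3 : (-1 : ℂ) ^ (2 : ℤ) = 1 := by norm_num
    rw [h, g1, g2, hr, sexticTerm, hpow, hpow, hneg, g3]
    linear_combination (-3 * (-1) ^ l / (1 - q ^ (3 * (6 * l + 5)))) * hq2
  rw [b0, b1, b2]
  ring

lemma qPochInf_cube_roots {P : ℂ} (hP : ‖P‖ < 1) :
    qPochInf P P * qPochInf (P * zeta3) P * qPochInf (P * zeta3 ^ 2) P
      = qPochInf (P ^ 3) (P ^ 3) := by
  have m1 := multipliable_one_sub_pow_mul hP P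
  have m2 := multipliable_one_sub_pow_mul hP (P * zeta3)
  have m3 := multipliable_one_sub_pow_mul hP (P * zeta3 ^ 2)
  rw [qPochInf, qPochInf, qPochInf, qPochInf, ← m1.tprod_mul m2, ← (m1.mul m2).tprod_mul m3]
  refine tprod_congr fun i => ?_
  linear_combination -one_sub_cube (P ^ i * P)

/-- In the triple product at c = ζ₃, splitting 1 - ζ₃² off (ζ₃²;q²)_∞ leaves three products, one for
each cube root of unity, that multiply to (q^6;q^6)_∞. -/
lemma theta_zeta3 (h0 : q ≠ 0) (h1 : ‖q‖ < 1) :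
    ∑' n : ℤ, (-zeta3) ^ n * q ^ (n ^ 2 + n) = (1 - zeta3 ^ 2) * qPochInf (q ^ 6) (q ^ 6) := by
  have hP := norm_sq_lt_one h1
  have hinv : 1 / zeta3 = zeta3 ^ 2 := by
    rw [div_eq_iff zeta3_ne_zero, ← pow_succ, zeta3_cube]
  rw [tsum_triple_product h0 h1 zeta3_ne_zero, hinv, qPochInf_eq_mul hP (zeta3 ^ 2),
    show q ^ 6 = (q ^ 2) ^ 3 by ring, ← qPochInf_cube_roots hP]
  ring

/-- Under n ↦ -1-n the denominator becomes 1 - ζ₃/y with y = q^{2n+1}, and -1/(1 - ζ₃/y) = 1/(1 -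
ζ₃²y) - 1; the -1 produces the theta series of `theta_zeta3`. -/
lemma tsum_appellTerm_zeta3 (h0 : q ≠ 0) (h1 : ‖q‖ < 1) :
    ∑' n, appellTerm zeta3 q n = zeta3 * ∑' n, appellTerm (zeta3 ^ 2) q n
      - zeta3 * ((1 - zeta3 ^ 2) * qPochInf (q ^ 6) (q ^ 6)) := by
  have s1 := summable_appellTerm h0 h1 (pow_ne_zero 2 zeta3_ne_zero)
  have s2 := summable_zpow_mul_gaussian h0 h1 (-zeta3) (neg_ne_zero.mpr zeta3_ne_zero)
  rw [← theta_zeta3 h0 h1, ← mul_sub, ← Summable.tsum_sub s1 s2, ← tsum_mul_left,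
    ← (Equiv.subLeft (-1 : ℤ)).tsum_eq]
  refine tsum_congr fun n => ?_
  have hz0 := zeta3_ne_zero
  have hd := one_sub_mul_zpow_ne_zero h1 (x := zeta3 ^ 2)
    (by rw [norm_pow, norm_zeta3, one_pow]) (show 2 * n + 1 ≠ 0 by omega)
  have hy := zpow_ne_zero (2 * n + 1) h0
  have e1 : zeta3 ^ (2 * (-1 - n)) = zeta3 * zeta3 ^ n := by
    have : zeta3 ^ (3 * (n + 1)) = 1 := by
      rw [zpow_mul, show zeta3 ^ (3 : ℤ) = 1 by rw [← zeta3_cube]; norm_cast, one_zpow]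
    rw [← mul_one (zeta3 ^ (2 * (-1 - n))), ← this, ← zpow_add₀ hz0, ← zpow_one_add₀ hz0]
    congr 1; ring
  have e2 : (zeta3 ^ 2) ^ (2 * n) = zeta3 ^ n := by
    have : zeta3 ^ (3 * n) = 1 := by
      rw [zpow_mul, show zeta3 ^ (3 : ℤ) = 1 by rw [← zeta3_cube]; norm_cast, one_zpow]
    rw [← mul_one (zeta3 ^ n), ← this, ← zpow_add₀ hz0, ← zpow_natCast, ← zpow_mul]
    congr 1; push_cast; ring
  have e3 : (-1 : ℂ) ^ (-1 - n) = -(-1) ^ n := by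
    rw [zpow_sub₀ (by norm_num), zpow_neg_one, inv_neg_one, div_eq_mul_inv, ← inv_zpow,
      inv_neg_one]
    ring
  have e4 : (-1 - n) ^ 2 + (-1 - n) = n ^ 2 + n := by ring
  have e5 : q ^ (2 * (-1 - n) + 1) = (q ^ (2 * n + 1))⁻¹ := by
    rw [← zpow_neg]; congr 1; ring
  rw [Equiv.subLeft_apply, appellTerm, appellTerm, e1, e2, e3, e4, e5, neg_eq_neg_one_mul zeta3,
    mul_zpow]
  have hz3 := zeta3_cube
  generalize q ^ (2 * n + 1) = y at *
  generalize zeta3 ^ n = u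
  have hd2 : y - zeta3 ≠ 0 := fun h => hd (by linear_combination -zeta3 ^ 2 * h - hz3)
  have hd3 : 1 - zeta3 * y⁻¹ = (y - zeta3) / y := by field_simp
  rw [hd3]
  field_simp
  linear_combination (u * y) * hz3

lemma qPoch_even_odd (x : ℂ) (n : ℕ) :
    qPoch x x (n + n) = qPoch x (x ^ 2) n * qPoch (x ^ 2) (x ^ 2) n := by
  induction n with
  | zero => simp [qPoch_zero]
  | succ n ih =>
    rw [show n + 1 + (n + 1) = (n + n) + 1 + 1 by ring, qPoch_succ, qPoch_succ, ih, qPoch_succ,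
      qPoch_succ]
    ring

lemma qPochInf_even_odd {x : ℂ} (hx : ‖x‖ < 1) :
    qPochInf x x = qPochInf x (x ^ 2) * qPochInf (x ^ 2) (x ^ 2) := by
  have hP := norm_sq_lt_one hx
  refine tendsto_nhds_unique ((tendsto_qPoch hx x).comp
    (tendsto_atTop_mono (fun n => Nat.le_add_left n n) tendsto_id)) ?_
  simp only [Function.comp_def, qPoch_even_odd]
  exact (tendsto_qPoch hP x).mul (tendsto_qPoch hP _)

/-- `tsum_appell_one` at x = r = q gives (q²;q²)_∞²/(q;q²)_∞², and J₁ = (q;q²)_∞ J₂ by separating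
odd and even exponents. -/
lemma tsum_appellTerm_one (h0 : q ≠ 0) (h1 : ‖q‖ < 1) :
    ∑' n, appellTerm 1 q n = J 2 q ^ 4 / J 1 q ^ 2 := by
  have hP := norm_sq_lt_one h1
  have h := tsum_appell_one h0 h1 h0 (fun l => by
    rw [← zpow_natCast, ← zpow_mul, ← zpow_one_add₀ h0]
    exact one_sub_zpow_ne_zero h1 (by push_cast; omega))
  have hne := qPochInf_self_ne_zero hP
  rw [J, J, pow_one, qPochInf_even_odd h1]
  rw [show q ^ 2 / q = q by field_simp] at h
  rw [show qPochInf (q ^ 2) (q ^ 2) ^ 4 / (qPochInf q (q ^ 2) * qPochInf (q ^ 2) (q ^ 2)) ^ 2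
    = qPochInf (q ^ 2) (q ^ 2) ^ 2 / (qPochInf q (q ^ 2) * qPochInf q (q ^ 2)) by
      rw [mul_pow, sq (qPochInf q (q ^ 2))]
      rcases eq_or_ne (qPochInf q (q ^ 2)) 0 with hz | hz
      · simp [hz]
      · field_simp, ← h]
  refine tsum_congr fun n => ?_
  rw [appellTerm_eq h0]
  simp

end Appell


end MockTheta

/-- All series and products that occur converge, and the identity holds. -/
theorem mainTheorem1 (q : ℂ) (hq0 : q ≠ 0) (hq1 : ‖q‖ < 1) :
    Summable (MockTheta.omega3Term (q ^ 3)) ∧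
    (∀ a : ℕ, 1 ≤ a → Multipliable (fun i : ℕ => 1 - (q ^ a) ^ i * q ^ a)) ∧
    Summable (MockTheta.bilateralTerm q) ∧
    2 * q ^ 2 * MockTheta.omega3 (q ^ 3) =
      -(2 * Complex.I / (Real.sqrt 3 : ℂ))
      + 2 / 3 * (MockTheta.J 2 q ^ 4 / (MockTheta.J 6 q * MockTheta.J 1 q ^ 2))
      - 4 / 3 * (Complex.exp (-(Real.pi * Complex.I) / 3)
          / MockTheta.qPochInf (q ^ 6) (q ^ 6))
        * ∑' n : ℤ, MockTheta.bilateralTerm q n := by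
  have hQ0 : q ^ 3 ≠ 0 := pow_ne_zero 3 hq0
  have hpow : ∀ n : ℕ, n ≠ 0 → ‖q ^ n‖ < 1 := fun n hn => by
    rw [norm_pow]; exact pow_lt_one₀ (norm_nonneg _) hq1 hn
  have hQ1 := hpow 3 three_ne_zero
  refine ⟨?_, fun a ha => MockTheta.multipliable_one_sub_pow_mul (hpow a (by omega)) _,
    MockTheta.summable_appellTerm hq0 hq1 MockTheta.zeta3_ne_zero, ?_⟩
  · have hx : ∀ l : ℤ, 1 - q ^ 3 * ((q ^ 3) ^ 2) ^ l ≠ 0 := fun l => by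
      rw [← zpow_natCast (q ^ 3) 2, ← zpow_mul, ← zpow_one_add₀ hQ0]
      exact MockTheta.one_sub_zpow_ne_zero hQ1 (by push_cast; omega)
    refine (MockTheta.summable_universal_mock hQ0 hQ1 hQ0 hx).congr fun n => ?_
    rw [show (q ^ 3) ^ 2 / q ^ 3 = q ^ 3 by field_simp, MockTheta.omega3Term, sq (MockTheta.qPoch _ _ _)]
  · have h1 := MockTheta.one_add_zeta3_combination hq0 hq1
    have h2 := MockTheta.universal_mock_eq_sexticSum hQ0 hQ1
    have h3 := MockTheta.tsum_appellTerm_zeta3 hq0 hq1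
    have h4 := MockTheta.tsum_appellTerm_one hq0 hq1
    have hne := MockTheta.qPochInf_self_ne_zero (hpow 6 (by norm_num))
    have hs := MockTheta.sqrt_three_sq
    have hs0 : (Real.sqrt 3 : ℂ) ≠ 0 := fun h => by rw [h] at hs; norm_num at hs
    have hz := MockTheta.zeta3_cube
    have hsub := MockTheta.zeta3_sq_sub
    have hI : 2 * Complex.I / (Real.sqrt 3 : ℂ) = 2 / 3 * (Real.sqrt 3 * Complex.I) := by
      rw [div_eq_iff hs0]
      linear_combination (-(2 / 3) * Complex.I) * hs
    rw [← h2, show (q ^ 3) ^ 2 = q ^ 6 by ring, h4] at h1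
    rw [MockTheta.exp_neg_pi_div_three_eq_neg_zeta3, hI,
      show MockTheta.J 6 q = MockTheta.qPochInf (q ^ 6) (q ^ 6) from rfl, mul_comm
      (MockTheta.qPochInf (q ^ 6) (q ^ 6)), ← div_div,
      show MockTheta.bilateralTerm q = MockTheta.appellTerm MockTheta.zeta3 q from rfl]
    generalize MockTheta.J 2 q ^ 4 / MockTheta.J 1 q ^ 2 = A1 at *
    generalize MockTheta.qPochInf (q ^ 6) (q ^ 6) = F at *
    generalize ∑' n, MockTheta.appellTerm MockTheta.zeta3 q n = A at *
    generalize ∑' n, MockTheta.appellTerm (MockTheta.zeta3 ^ 2) q n = B at *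
    generalize MockTheta.zeta3 = z at *
    field_simp
    -- Eliminate B = A(ζ₃²): the reflection formula leaves ζ₃²(1 - ζ₃²)F, which equals (ζ₃² - ζ₃)F =
    -- -i√3 F and yields the constant -2i/√3.
    linear_combination -2 * h1 - 2 * z * h3 + 2 * F * hsub - 2 * F * z * hz
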